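/- Consider the Hamiltonian system $$\dot\lambda=-3\Lambda,\qquad \dot\Lambda=-\sin\lambda\left(1-\frac{1}{(2+2\cos\lambda)^{3/2}}\right),$$ with $\lambda\neq\pi \pmod{2\pi}$, whose Hamiltonian is $-\frac32\Lambda^2+1-\cos\lambda-\frac{1}{\sqrt{2+2\cos\lambda}}$. There is exactly one solution $\sigma(t)=(\lambda_h(t),\Lambda_h(t))$, $t\in\mathbb R$, that is homoclinic to the saddle $(0,0)$ (that is, $\sigma(t)\to(0,0)$ as $t\to\pm\infty$) and has initial condition $\sigma(0)=(\lambda_0,0)$ with $\lambda_0\in(\frac23\pi,\pi)$; here the angle is lifted to $\mathbb R$. Let $a_\pm=-\frac12\pm\frac{\sqrt2}{2}$, $$A=\int_0^{a_+}\frac{1}{1-x}\sqrt{\frac{x}{3(x+1)(a_+-x)(x-a_-)}}\,dx,$$ and $\Pi_A=\{t\in\mathbb C : |\operatorname{Im} t|<A\}$. Then $\Lambda_h$ has an analytic continuation to a neighbourhood of every point of $\overline{\Pi_A}\setminus\{iA,-iA\}$. For every such continuation, its only zero in $\overline{\Pi_A}\setminus\{iA,-iA\}$ is $t=0$, and $|\Lambda_h(t)|\to\infty$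 as $t\to\pm iA$ within this set. In particular, $t=0$ is the only zero of $\Lambda_h$ in $\overline{\Pi_A}$. -/

import Mathlib

open Filter Topology Set

/-- The vector field of the Hamiltonian system with Hamiltonian
`-(3/2) Λ ^ 2 + 1 - cos lam - 1 / √(2 + 2 cos lam)`, at the point `p = (lam, Λ)`. -/
noncomputable def pendulumField (p : ℝ × ℝ) : ℝ × ℝ :=
  (-3 * p.2, -Real.sin p.1 * (1 - 1 / (2 + 2 * Real.cos p.1) ^ (3 / 2 : ℝ)))

/-- `σ = (lam_h, Λ_h)` is the time parametrization of the right-hand separatrix of the saddle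
`(0, 0)`: a global solution that stays away from the collision `lam = π`, is homoclinic to
`(0, 0)`, and starts at a point `(lam₀, 0)` with `2 π / 3 < lam₀ < π`. The angle is written through
its lift to `ℝ` with `lam_h 0` in `(2 π / 3, π)`. -/
structure IsSeparatrix (σ : ℝ → ℝ × ℝ) : Prop where
  hasDerivAt : ∀ t, HasDerivAt σ (pendulumField (σ t)) t
  collision_free : ∀ t, Real.cos (σ t).1 ≠ -1
  tendsto_atTop : Tendsto σ atTop (𝓝 (0, 0))
  tendsto_atBot : Tendsto σ atBot (𝓝 (0, 0))
  init_angle : (σ 0).1 ∈ Ioo (2 * Real.pi / 3) Real.pi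
  init_momentum : (σ 0).2 = 0

noncomputable def aPlus : ℝ := -1 / 2 + √2 / 2

noncomputable def aMinus : ℝ := -1 / 2 - √2 / 2

/-- The half-width `A` of the strip of analyticity, approximately `0.177744`. -/
noncomputable def stripWidth : ℝ :=
  ∫ x in (0 : ℝ)..aPlus,
    1 / (1 - x) * √(x / (3 * (x + 1) * (aPlus - x) * (x - aMinus)))

/-- The open complex strip of half-width `A` around the real axis. -/
def openStrip : Set ℂ := {t : ℂ | |t.im| < stripWidth}

/-- The closed strip without the two singularities `± i A`. -/
def puncturedClosedStrip : Set ℂ :=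
  closure openStrip \ {Complex.I * stripWidth, -(Complex.I * stripWidth)}

/-- `g` is an analytic continuation of `f : ℝ → ℝ` to the closed strip without `± i A`, that is,
to a neighbourhood of each of its points. -/
def IsStripContinuation (f : ℝ → ℝ) (g : ℂ → ℂ) : Prop :=
  AnalyticOnNhd ℂ g puncturedClosedStrip ∧ ∀ t : ℝ, g (t : ℂ) = (f t : ℂ)

/-! ### The principal square root on the slit plane -/

section ComplexSqrt

open Complex

/-! The separatrix lies on the energy level of the saddle. With q = cos(λ/2), that level gives Λ² as
a constant times (1 - q)(q - a₊)(q - a₋)/q, so q itself ramifies at the turning point a₊. Put q =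
z/(1 + z) and z = N + u², where N = `sepN` corresponds to a₊ and -M = -`sepM` to a₋. The saddle goes
to u = ∞, the turning point to u = 0 and the collision q = 0 to z = 0. Both momentum and dt/du
become explicit products of principal square roots in z, and everything reduces to inverting the
time map u ↦ t.

Let D be the region Re z > 0 between the two branches of the hyperbola (Im u)² = N + (Re u)². Three
facts carry the inversion. The real part of dt/du is positive off the cuts (`densityZ_re_pos`),
which with the sign of Re t gives injectivity on D (`injOn_timeMap`). A phase estimate on the
hyperbola shows that the boundary of D is sent strictly outside the closed strip of half-width A,
except for the corners ±i√N, which go to ±iA (`cornerHeight_lt_abs_im_timeMap`). Finally, the time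
map is proper on the closure of D (`exists_norm_le_of_norm_timeMap_le`). A connectedness argument
then puts the punctured closed strip inside the image of D (`timeStrip_subset_image`), so u is a
holomorphic function of t there.

The momentum is an explicit function of u that vanishes on D only at u = 0, that is t = 0, and blows
up as z → 0, that is at the corners. The integral for A is the time along the imaginary segment from
0 to i√N. The identity theorem transfers the conclusions to every continuation; conservation of
energy and uniqueness for the differential equation identify every separatrix with the explicit one.
-/

theorem Complex.sqrt_mul_self' (z : ℂ) : z.sqrt * z.sqrt = z := by
  rw [← sq, Complex.sqrt]
  exact_mod_cast cpow_nat_inv_pow z (n := 2) two_ne_zero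

theorem Complex.re_sqrt_pos {z : ℂ} (hz : z ∈ slitPlane) : 0 < z.sqrt.re := by
  rw [Complex.sqrt, cpow_inv_two_re]
  apply Real.sqrt_pos.mpr
  have h1 := abs_re_le_norm z
  rcases mem_slitPlane_iff.mp hz with h | h
  · have := norm_nonneg z
    linarith
  · have h2 : |z.re| < ‖z‖ := abs_re_lt_norm.mpr h
    have := neg_abs_le z.re
    linarith

theorem Complex.sqrt_ne_zero' {z : ℂ} (hz : z ∈ slitPlane) : z.sqrt ≠ 0 := fun h => by
  have := re_sqrt_pos hz
  simp [h] at this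

theorem Complex.im_sqrt_pos {z : ℂ} (hz : 0 < z.im) : 0 < z.sqrt.im := by
  rw [Complex.sqrt, cpow_inv_two_im_eq_sqrt hz.le]
  apply Real.sqrt_pos.mpr
  have h2 : |z.re| < ‖z‖ := abs_re_lt_norm.mpr hz.ne'
  have := le_abs_self z.re
  linarith

theorem Complex.sqrt_conj {z : ℂ} (hz : z ∈ slitPlane) :
    (starRingEnd ℂ z).sqrt = starRingEnd ℂ z.sqrt := by
  rw [Complex.sqrt, Complex.sqrt, conj_cpow _ _ (slitPlane_arg_ne_pi hz)]
  simp only [map_inv₀, map_ofNat]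

theorem Complex.sqrt_ofReal {x : ℝ} (hx : 0 ≤ x) : (x : ℂ).sqrt = (√x : ℝ) := by
  rw [sqrt_of_nonneg (by exact_mod_cast hx), ofReal_re]

theorem Complex.norm_sqrt (z : ℂ) : ‖z.sqrt‖ = √‖z‖ := by
  rw [eq_comm, Real.sqrt_eq_iff_mul_self_eq (norm_nonneg _) (norm_nonneg _), ← norm_mul,
    sqrt_mul_self']

theorem Complex.re_mul_self_sqrt (z : ℂ) : z.sqrt.re ^ 2 - z.sqrt.im ^ 2 = z.re := by
  have := congrArg re (sqrt_mul_self' z)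
  simp only [mul_re] at this
  linarith

theorem Complex.im_mul_self_sqrt (z : ℂ) : 2 * z.sqrt.re * z.sqrt.im = z.im := by
  have := congrArg im (sqrt_mul_self' z)
  simp only [mul_im] at this
  linarith

theorem Complex.analyticAt_sqrt {z : ℂ} (hz : z ∈ slitPlane) : AnalyticAt ℂ Complex.sqrt z :=
  (differentiableOn_sqrt.analyticOnNhd isOpen_slitPlane) z hz

theorem Complex.ofReal_mul_mem_slitPlane {z : ℂ} (hz : z ∈ slitPlane) {c : ℝ} (hc : 0 < c) :
    (c : ℂ) * z ∈ slitPlane := by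
  rw [mem_slitPlane_iff] at *
  rcases hz with h | h
  · left; simpa using mul_pos hc h
  · right; simpa using ⟨hc.ne', h⟩

theorem Complex.add_ofReal_mem_slitPlane {z : ℂ} (hz : z ∈ slitPlane) {c : ℝ} (hc : 0 ≤ c) :
    z + (c : ℂ) ∈ slitPlane := by
  rw [mem_slitPlane_iff] at *
  rcases hz with h | h
  · left; simp; linarith
  · right; simpa using h

/-- In the first quadrant, a square root turns towards the real axis when a positive real is added
to the radicand. -/
theorem mul_lt_mul_of_sq_sub_sq {p₁ p₂ s₁ s₂ m : ℝ} (hp₁ : 0 < p₁) (hp₂ : 0 < p₂) (hs₁ : 0 < s₁)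
    (hs₂ : 0 < s₂) (h : p₁ * p₂ = s₁ * s₂) (hm : 0 < m)
    (hsub : s₁ ^ 2 - s₂ ^ 2 = p₁ ^ 2 - p₂ ^ 2 + m) : p₁ * s₂ < p₂ * s₁ := by
  have h1 : p₁ < s₁ := by
    by_contra! hle
    have h2 : p₂ ≤ s₂ := by
      by_contra! h3
      nlinarith [mul_lt_mul' hle h3 hs₂.le hp₁]
    nlinarith
  have h2 : s₂ < p₂ := by
    by_contra! h3
    nlinarith [mul_lt_mul h1 h3 hp₂ hs₁.le]
  exact (mul_lt_mul_of_pos_left h2 hp₁).trans ((mul_lt_mul_of_pos_right h1 hp₂).trans_eq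
    (mul_comm _ _))

/-- Cross product form of arg √(z + c) < arg √z; the two radicands share their imaginary part. -/
theorem Complex.sqrt_add_ofReal_turn {z : ℂ} (hz : 0 < z.im) {c : ℝ} (hc : 0 < c) :
    z.sqrt.re * (z + c).sqrt.im < z.sqrt.im * (z + c).sqrt.re := by
  have hz' : z ∈ slitPlane := mem_slitPlane_iff.mpr (Or.inr hz.ne')
  have hw : 0 < (z + c).im := by simpa using hz
  have hw' : z + c ∈ slitPlane := mem_slitPlane_iff.mpr (Or.inr hw.ne')
  refine mul_lt_mul_of_sq_sub_sq (m := c) (re_sqrt_pos hz') (im_sqrt_pos hz) (re_sqrt_pos hw')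
    (im_sqrt_pos hw) ?_ hc ?_
  · have h1 := im_mul_self_sqrt z
    have h2 := im_mul_self_sqrt (z + c)
    simp only [add_im, ofReal_im, add_zero] at h2
    linarith
  · rw [re_mul_self_sqrt, re_mul_self_sqrt]
    simp

end ComplexSqrt

/-! ### The derivative of time and the positivity of its real part -/

section TimeDensity

open Complex

/-- The variable `u` used below satisfies `cos (lam / 2) = z / (1 + z)` for `z = sepN + u ^ 2`. -/
noncomputable def sepN : ℝ := (2 * √2 - 1) / 7

/-- The other root a₋ of the energy relation corresponds to z = -`sepM`. -/
noncomputable def sepM : ℝ := (2 * √2 + 1) / 7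

theorem sepN_pos : 0 < sepN := by
  have : 1 ≤ √2 := Real.one_le_sqrt.mpr (by norm_num)
  rw [sepN]; linarith

theorem sepN_lt_sepM : sepN < sepM := by
  rw [sepM, sepN]; linarith

theorem sepM_pos : 0 < sepM := sepN_pos.trans sepN_lt_sepM

theorem sepM_eq : sepM = sepN + 2 / 7 := by rw [sepM, sepN]; ring

theorem sepM_mul_sepN : sepM * sepN = 1 / 7 := by
  rw [sepM, sepN]
  have := Real.mul_self_sqrt (show (0 : ℝ) ≤ 2 by norm_num)
  linear_combination (4 / 49) * this

theorem sepN_lt_one : sepN < 1 := by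
  nlinarith [sepM_mul_sepN, sepM_eq, sepN_pos]

theorem sepM_lt_one : sepM < 1 := by
  nlinarith [sepM_mul_sepN, sepM_eq, sepN_pos]

noncomputable def sepZ (u : ℂ) : ℂ := sepN + u ^ 2

/-- The derivative of time with respect to `u` as a function of `z = sepZ u`. -/
noncomputable def densityZ (z : ℂ) : ℂ :=
  (4 / √21 : ℝ) * (z.sqrt / ((2 * z + 1).sqrt * (z + sepM).sqrt))

/-- The derivative of time with respect to `u`. -/
noncomputable def timeDensity (u : ℂ) : ℂ := densityZ (sepZ u)

def timeDomain : Set ℂ := {u : ℂ | sepZ u ∈ slitPlane}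

theorem two_mul_add_one_mem_slitPlane {z : ℂ} (hz : z ∈ slitPlane) : 2 * z + 1 ∈ slitPlane := by
  exact_mod_cast add_ofReal_mem_slitPlane
    (ofReal_mul_mem_slitPlane hz (c := 2) two_pos) (c := 1) zero_le_one

theorem add_sepM_mem_slitPlane {z : ℂ} (hz : z ∈ slitPlane) : z + sepM ∈ slitPlane :=
  add_ofReal_mem_slitPlane hz sepM_pos.le

theorem four_div_sqrt_pos : 0 < 4 / √21 := by positivity

theorem densityZ_conj {z : ℂ} (hz : z ∈ slitPlane) :
    densityZ (starRingEnd ℂ z) = starRingEnd ℂ (densityZ z) := by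
  have h1 := sqrt_conj (two_mul_add_one_mem_slitPlane hz)
  have h2 := sqrt_conj (add_sepM_mem_slitPlane hz)
  simp only [map_add, map_mul, map_ofNat, map_one, conj_ofReal] at h1 h2
  simp only [densityZ, map_mul, map_div₀, conj_ofReal, h1, h2, sqrt_conj hz]

theorem re_div_pos_iff {a b : ℂ} (hb : b ≠ 0) :
    0 < (a / b).re ↔ 0 < (a * starRingEnd ℂ b).re := by
  have hb' : 0 < normSq b := normSq_pos.mpr hb
  have : (a / b).re = (a * starRingEnd ℂ b).re / normSq b := by
    rw [div_re]; simp; ring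
  rw [this, div_pos_iff_of_pos_right hb']

/-- The phase is (arg √z - arg √(z + M)) - arg √(2z + 1). The first difference lies in (0, π/2)
because adding M turns the root towards the real axis, and the last term lies in (0, π/2) too, so
the total stays within (-π/2, π/2). -/
theorem densityZ_re_pos_of_im_pos {z : ℂ} (hz : 0 < z.im) : 0 < (densityZ z).re := by
  have hz' : z ∈ slitPlane := mem_slitPlane_iff.mpr (Or.inr hz.ne')
  have hw : 0 < (2 * z + 1).im := by simpa using hz
  have h2 := two_mul_add_one_mem_slitPlane hz'
  have h3 := add_sepM_mem_slitPlane hz'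
  have hv : 0 < (z + sepM).im := by simpa using hz
  rw [densityZ, re_ofReal_mul]
  refine mul_pos four_div_sqrt_pos ?_
  rw [re_div_pos_iff (mul_ne_zero (sqrt_ne_zero' h2) (sqrt_ne_zero' h3))]
  have ht := sqrt_add_ofReal_turn hz sepM_pos
  simp only [map_mul, mul_re, mul_im, conj_re, conj_im]
  have p1 := re_sqrt_pos hz'
  have p2 := im_sqrt_pos hz
  have s1 := re_sqrt_pos h3
  have s2 := im_sqrt_pos hv
  have r1 := re_sqrt_pos h2
  have r2 := im_sqrt_pos hw
  set p := z.sqrt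
  set s := (z + (sepM : ℂ)).sqrt
  set r := (2 * z + 1).sqrt
  -- This is Re(p s̄) Re r + Im(p s̄) Im r, the expansion of Re(p s̄ r̄).
  have key : 0 < (p.re * s.re + p.im * s.im) * r.re + (p.im * s.re - p.re * s.im) * r.im := by
    have : 0 < p.im * s.re - p.re * s.im := by linarith
    positivity
  nlinarith [key]

theorem densityZ_ofReal {x : ℝ} (hx : 0 ≤ x) :
    densityZ x = (4 / √21 * (√x / (√(2 * x + 1) * √(x + sepM))) : ℝ) := by
  have h1 : (2 * (x : ℂ) + 1).sqrt = (√(2 * x + 1) : ℝ) := by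
    rw [← sqrt_ofReal (by positivity)]; push_cast; rfl
  have h2 : ((x : ℂ) + sepM).sqrt = (√(x + sepM) : ℝ) := by
    rw [← sqrt_ofReal (add_nonneg hx sepM_pos.le)]; push_cast; rfl
  rw [densityZ, h1, h2, sqrt_ofReal hx]
  push_cast
  rfl

theorem densityZ_re_pos {z : ℂ} (hz : z ∈ slitPlane) : 0 < (densityZ z).re := by
  rcases lt_trichotomy z.im 0 with h | h | h
  · have := densityZ_re_pos_of_im_pos (z := starRingEnd ℂ z) (by simpa using h)
    rwa [densityZ_conj hz, conj_re] at this
  · have hre : 0 < z.re := by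
      rcases mem_slitPlane_iff.mp hz with h' | h'
      · exact h'
      · exact absurd h h'
    have hzr : z = (z.re : ℂ) := Complex.ext (by simp) (by simpa using h)
    rw [hzr, densityZ_ofReal hre.le, ofReal_re]
    have := sepM_pos
    positivity
  · exact densityZ_re_pos_of_im_pos h

theorem timeDensity_re_pos {u : ℂ} (hu : u ∈ timeDomain) : 0 < (timeDensity u).re :=
  densityZ_re_pos hu

theorem timeDensity_ne_zero {u : ℂ} (hu : u ∈ timeDomain) : timeDensity u ≠ 0 := fun h => by
  have := timeDensity_re_pos hu
  simp [h] at this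

theorem analyticAt_densityZ {z : ℂ} (hz : z ∈ slitPlane) : AnalyticAt ℂ densityZ z := by
  have h2 := two_mul_add_one_mem_slitPlane hz
  have h3 := add_sepM_mem_slitPlane hz
  have e2 : AnalyticAt ℂ (fun z : ℂ => (2 * z + 1).sqrt) z :=
    AnalyticAt.fun_comp (f := fun z : ℂ => 2 * z + 1) (analyticAt_sqrt h2) (by fun_prop)
  have e3 : AnalyticAt ℂ (fun z : ℂ => (z + sepM).sqrt) z :=
    AnalyticAt.fun_comp (f := fun z : ℂ => z + sepM) (analyticAt_sqrt h3) (by fun_prop)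
  exact analyticAt_const.mul ((analyticAt_sqrt hz).div (e2.mul e3)
    (mul_ne_zero (sqrt_ne_zero' h2) (sqrt_ne_zero' h3)))

theorem continuous_sepZ : Continuous sepZ := by unfold sepZ; fun_prop

theorem analyticAt_sepZ (u : ℂ) : AnalyticAt ℂ sepZ u := by unfold sepZ; fun_prop

theorem isOpen_timeDomain : IsOpen timeDomain := isOpen_slitPlane.preimage continuous_sepZ

theorem analyticAt_timeDensity {u : ℂ} (hu : u ∈ timeDomain) : AnalyticAt ℂ timeDensity u :=
  (analyticAt_densityZ hu).comp (analyticAt_sepZ u)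

theorem sepZ_re (u : ℂ) : (sepZ u).re = sepN + (u.re ^ 2 - u.im ^ 2) := by
  simp [sepZ, sq]

theorem sepZ_im (u : ℂ) : (sepZ u).im = 2 * u.re * u.im := by
  simp [sepZ, sq]; ring

/-- The cuts are the two rays of the imaginary axis from ±i√N outwards, so the domain is star-shaped
about 0 and contains the right half plane. -/
theorem mem_timeDomain_iff {u : ℂ} : u ∈ timeDomain ↔ u.re ≠ 0 ∨ u.im ^ 2 < sepN := by
  rw [timeDomain, mem_ofPred_eq, mem_slitPlane_iff, sepZ_re, sepZ_im]
  have := sepN_pos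
  constructor
  · rintro (h | h)
    · by_cases h0 : u.re = 0
      · right; rw [h0] at h; linarith
      · exact Or.inl h0
    · left; rintro h0; simp [h0] at h
  · rintro (h | h)
    · by_cases h0 : u.im = 0
      · left; rw [h0]; have := sq_nonneg u.re; linarith
      · right; simp [h, h0]
    · left; have := sq_nonneg u.re; linarith

theorem smul_mem_timeDomain {u : ℂ} (hu : u ∈ timeDomain) {x : ℝ} (hx : x ∈ Icc (0 : ℝ) 1) :
    (x : ℂ) * u ∈ timeDomain := by
  rw [mem_timeDomain_iff] at *
  simp only [re_ofReal_mul, im_ofReal_mul, mul_pow]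
  have hN := sepN_pos
  have hx2 : x ^ 2 ≤ 1 := by nlinarith [hx.1, hx.2]
  rcases hu with h | h
  · by_cases h0 : x = 0
    · right; simp [h0, hN]
    · left; exact mul_ne_zero h0 h
  · right; nlinarith [sq_nonneg u.im, sq_nonneg x]

theorem sepZ_conj (u : ℂ) : sepZ (starRingEnd ℂ u) = starRingEnd ℂ (sepZ u) := by
  simp [sepZ]

theorem sepZ_neg (u : ℂ) : sepZ (-u) = sepZ u := by simp [sepZ]

theorem timeDensity_neg (u : ℂ) : timeDensity (-u) = timeDensity u := by
  rw [timeDensity, timeDensity, sepZ_neg]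

theorem timeDensity_conj {u : ℂ} (hu : u ∈ timeDomain) :
    timeDensity (starRingEnd ℂ u) = starRingEnd ℂ (timeDensity u) := by
  rw [timeDensity, timeDensity, sepZ_conj, densityZ_conj hu]

end TimeDensity

/-! ### The time map: holomorphy, continuity up to the boundary, injectivity on a half plane -/

section TimeMap

open Complex

/-- The time as a function of `u`. -/
noncomputable def timeMap (u : ℂ) : ℂ := ∫ x in (0 : ℝ)..1, u * timeDensity (x * u)

/-- The region of the `u` plane which contains the preimage of the strip. -/
def sepRegion : Set ℂ := {u : ℂ | 0 < (sepZ u).re}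

def sepClosedRegion : Set ℂ := {u : ℂ | 0 ≤ (sepZ u).re}

/-- The point sent to the singularity. -/
noncomputable def sepCorner : ℂ := (√sepN : ℝ) * I

theorem sqrt_sepN_pos : 0 < √sepN := Real.sqrt_pos.mpr sepN_pos

theorem sq_sqrt_sepN : √sepN ^ 2 = sepN := Real.sq_sqrt sepN_pos.le

theorem mem_sepRegion {u : ℂ} : u ∈ sepRegion ↔ u.im ^ 2 < sepN + u.re ^ 2 := by
  rw [sepRegion, mem_ofPred_eq, sepZ_re]
  constructor <;> intro h <;> linarith

theorem mem_sepClosedRegion {u : ℂ} : u ∈ sepClosedRegion ↔ u.im ^ 2 ≤ sepN + u.re ^ 2 := by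
  rw [sepClosedRegion, mem_ofPred_eq, sepZ_re]
  constructor <;> intro h <;> linarith

theorem sepRegion_subset_timeDomain : sepRegion ⊆ timeDomain := fun _ hu =>
  mem_slitPlane_iff.mpr (Or.inl hu)

theorem sepRegion_subset_sepClosedRegion : sepRegion ⊆ sepClosedRegion := fun u hu => by
  rw [mem_sepClosedRegion]
  exact (mem_sepRegion.mp hu).le

theorem isOpen_sepRegion : IsOpen sepRegion :=
  isOpen_lt continuous_const (continuous_re.comp continuous_sepZ)

theorem isClosed_sepClosedRegion : IsClosed sepClosedRegion :=
  isClosed_le continuous_const (continuous_re.comp continuous_sepZ)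

theorem smul_mem_sepClosedRegion {u : ℂ} (hu : u ∈ sepClosedRegion) {x : ℝ}
    (hx : x ∈ Icc (0 : ℝ) 1) : (x : ℂ) * u ∈ sepClosedRegion := by
  rw [mem_sepClosedRegion] at *
  simp only [re_ofReal_mul, im_ofReal_mul, mul_pow]
  have hN := sepN_pos
  have hx2 : x ^ 2 ≤ 1 := by nlinarith [hx.1, hx.2]
  nlinarith [sq_nonneg u.im, sq_nonneg x]

/-- A thickening of the segment [0, u] is convex and still inside the domain, so the density has a
primitive there; the radial integral is that primitive up to a constant. -/
theorem hasDerivAt_timeMap {u : ℂ} (hu : u ∈ timeDomain) :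
    HasDerivAt timeMap (timeDensity u) u := by
  have hseg : segment ℝ 0 u ⊆ timeDomain := by
    rintro v hv
    rw [segment_eq_image] at hv
    obtain ⟨x, hx, rfl⟩ := hv
    simpa using smul_mem_timeDomain hu hx
  have hcomp : IsCompact (segment ℝ 0 u) := by
    rw [segment_eq_image]
    exact isCompact_Icc.image (by fun_prop)
  obtain ⟨δ, hδ, hsub⟩ := hcomp.exists_thickening_subset_open isOpen_timeDomain hseg
  set C := Metric.thickening δ (segment ℝ 0 u)
  have hCconv : Convex ℝ C := (convex_segment 0 u).thickening δ
  have hCo : IsOpen C := Metric.isOpen_thickening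
  have hd : DifferentiableOn ℂ timeDensity C := fun v hv =>
    (analyticAt_timeDensity (hsub hv)).differentiableAt.differentiableWithinAt
  obtain ⟨G, hG⟩ := hCconv.exists_forall_hasDerivWithinAt hd
  have h0 : (0 : ℂ) ∈ C := Metric.self_subset_thickening hδ _ (left_mem_segment ℝ 0 u)
  have hu' : u ∈ C := Metric.self_subset_thickening hδ _ (right_mem_segment ℝ 0 u)
  have key : ∀ v ∈ C, timeMap v = G v - G 0 := by
    intro v hv
    have hmem : ∀ x ∈ uIcc (0 : ℝ) 1, (x : ℂ) * v ∈ C := by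
      intro x hx
      rw [uIcc_of_le zero_le_one] at hx
      apply hCconv.segment_subset h0 hv
      rw [segment_eq_image]
      exact ⟨x, hx, by simp⟩
    have hder : ∀ x ∈ uIcc (0 : ℝ) 1,
        HasDerivAt (fun x : ℝ => G (x * v)) (v * timeDensity (x * v)) x := by
      intro x hx
      have h1 := (hG _ (hmem x hx)).hasDerivAt (hCo.mem_nhds (hmem x hx))
      have h2 : HasDerivAt (fun x : ℝ => (x : ℂ) * v) v x := by
        simpa using (hasDerivAt_id x).ofReal_comp.mul_const v
      rw [mul_comm]
      exact h1.comp x h2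
    have hcont : ContinuousOn (fun x : ℝ => v * timeDensity (x * v)) (uIcc 0 1) := by
      refine continuousOn_const.mul ?_
      exact hd.continuousOn.comp (by fun_prop) hmem
    rw [timeMap, intervalIntegral.integral_eq_sub_of_hasDerivAt hder hcont.intervalIntegrable]
    simp
  have h1 := ((hG u hu').hasDerivAt (hCo.mem_nhds hu')).sub_const (G 0)
  refine h1.congr_of_eventuallyEq ?_
  filter_upwards [hCo.mem_nhds hu'] with v hv using key v hv

theorem timeMap_zero : timeMap 0 = 0 := by simp [timeMap]

theorem timeMap_neg (u : ℂ) : timeMap (-u) = -timeMap u := by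
  simp only [timeMap, mul_neg, timeDensity_neg, neg_mul, intervalIntegral.integral_neg]

/-- The only branch point in the closed half plane is z = 0, where the principal root is still
continuous. This lets the time map extend continuously to the corners. -/
theorem continuousAt_densityZ {z : ℂ} (hz : 0 ≤ z.re) : ContinuousAt densityZ z := by
  have h1 : 0 < (2 * z + 1).re := by simp; linarith
  have h2 : 0 < (z + sepM).re := by simp; linarith [sepM_pos]
  have c1 : ContinuousAt (fun z : ℂ => (2 * z + 1).sqrt) z :=
    ContinuousAt.comp' (f := fun z : ℂ => 2 * z + 1) (continuousAt_sqrt (Or.inl h1.le))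
      (by fun_prop)
  have c2 : ContinuousAt (fun z : ℂ => (z + sepM).sqrt) z :=
    ContinuousAt.comp' (f := fun z : ℂ => z + sepM) (continuousAt_sqrt (Or.inl h2.le))
      (by fun_prop)
  exact continuousAt_const.mul ((continuousAt_sqrt (Or.inl hz)).div (c1.mul c2)
    (mul_ne_zero (sqrt_ne_zero' (mem_slitPlane_iff.mpr (Or.inl h1)))
      (sqrt_ne_zero' (mem_slitPlane_iff.mpr (Or.inl h2)))))

theorem continuousOn_timeDensity : ContinuousOn timeDensity sepClosedRegion := fun _ hu =>
  ((continuousAt_densityZ hu).comp continuous_sepZ.continuousAt).continuousWithinAt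

theorem norm_densityZ (z : ℂ) :
    ‖densityZ z‖ = 4 / √21 * (√‖z‖ / (√‖2 * z + 1‖ * √‖z + sepM‖)) := by
  rw [densityZ, norm_mul, norm_div, norm_mul, norm_sqrt, norm_sqrt, norm_sqrt, norm_real,
    Real.norm_of_nonneg four_div_sqrt_pos.le]

theorem four_div_sqrt_le_one : 4 / √21 ≤ 1 := by
  rw [div_le_one (by positivity)]
  apply Real.le_sqrt_of_sq_le; norm_num

theorem norm_le_norm_add_of_re_nonneg {z : ℂ} (hz : 0 ≤ z.re) {c : ℝ} (hc : 0 ≤ c) :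
    ‖z‖ ≤ ‖z + c‖ := by
  rw [norm_def, norm_def]
  apply Real.sqrt_le_sqrt
  simp only [normSq_apply, add_re, add_im, ofReal_re, ofReal_im, add_zero]
  nlinarith

theorem norm_two_mul_add_one {z : ℂ} (hz : 0 ≤ z.re) :
    1 ≤ ‖2 * z + 1‖ ∧ 2 * ‖z‖ ≤ ‖2 * z + 1‖ := by
  constructor
  · refine le_trans ?_ (re_le_norm _)
    simp; linarith
  · have := norm_le_norm_add_of_re_nonneg (z := 2 * z) (by simpa using hz) zero_le_one
    simpa using this

/-- Since |z| ≤ |z + M| for Re z ≥ 0 and 4/√21 ≤ 1, only the factor √(2z + 1) in the denominator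
matters. -/
theorem norm_densityZ_le {z : ℂ} (hz : 0 ≤ z.re) : ‖densityZ z‖ * √‖2 * z + 1‖ ≤ 1 := by
  have h3 : 0 < ‖z + sepM‖ := by
    refine lt_of_lt_of_le ?_ (re_le_norm _)
    simp; linarith [sepM_pos]
  have h1 := (norm_two_mul_add_one hz).1
  have h4 := Real.sqrt_le_sqrt (norm_le_norm_add_of_re_nonneg hz sepM_pos.le)
  have h5 : 0 < √‖2 * z + 1‖ := Real.sqrt_pos.mpr (by linarith)
  have h6 : 0 < √‖z + sepM‖ := Real.sqrt_pos.mpr h3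
  rw [norm_densityZ]
  calc 4 / √21 * (√‖z‖ / (√‖2 * z + 1‖ * √‖z + sepM‖)) * √‖2 * z + 1‖
      = 4 / √21 * (√‖z‖ / √‖z + sepM‖) := by field_simp
    _ ≤ 1 * 1 := by
      refine mul_le_mul four_div_sqrt_le_one ?_ (by positivity) zero_le_one
      rwa [div_le_one h6]
    _ = 1 := one_mul 1

theorem norm_timeDensity_le_one {u : ℂ} (hu : u ∈ sepClosedRegion) : ‖timeDensity u‖ ≤ 1 := by
  have h1 := norm_densityZ_le hu
  have h2 : 1 ≤ √‖2 * sepZ u + 1‖ := Real.one_le_sqrt.mpr (norm_two_mul_add_one hu).1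
  have h3 := norm_nonneg (densityZ (sepZ u))
  rw [timeDensity]
  nlinarith

/-- Decay of order 1/|u|, which keeps the change of time along circular arcs bounded independently
of the radius. -/
theorem norm_mul_norm_timeDensity_le {u : ℂ} (hu : u ∈ sepClosedRegion) :
    ‖u‖ * ‖timeDensity u‖ ≤ 2 := by
  have h1 := norm_densityZ_le hu
  obtain ⟨h2, h3⟩ := norm_two_mul_add_one hu
  have h4 : ‖u‖ ^ 2 ≤ ‖sepZ u‖ + sepN := by
    have : u ^ 2 = sepZ u - sepN := by simp [sepZ]
    rw [← norm_pow, this]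
    refine (norm_sub_le _ _).trans ?_
    rw [norm_real, Real.norm_of_nonneg sepN_pos.le]
  have h5 : ‖u‖ ≤ 2 * √‖2 * sepZ u + 1‖ := by
    refine le_of_sq_le_sq ?_ (by positivity)
    rw [mul_pow, Real.sq_sqrt (norm_nonneg _)]
    linarith [sepN_lt_one]
  have h3 := norm_nonneg (densityZ (sepZ u))
  rw [timeDensity]
  nlinarith

theorem continuousOn_timeMap : ContinuousOn timeMap sepClosedRegion := by
  intro u hu
  unfold timeMap
  refine intervalIntegral.continuousWithinAt_of_dominated_interval
    (bound := fun _ => ‖u‖ + 1) ?_ ?_ intervalIntegrable_const ?_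
  · filter_upwards [self_mem_nhdsWithin] with v hv
    rw [uIoc_of_le zero_le_one]
    refine ContinuousOn.aestronglyMeasurable ?_ measurableSet_Ioc
    refine continuousOn_const.mul (continuousOn_timeDensity.comp (by fun_prop) ?_)
    exact fun x hx => smul_mem_sepClosedRegion hv (Ioc_subset_Icc_self hx)
  · have h1 : ∀ᶠ v in 𝓝[sepClosedRegion] u, ‖v‖ < ‖u‖ + 1 :=
      (continuous_norm.continuousWithinAt (s := sepClosedRegion) (x := u)).eventually
        (gt_mem_nhds (lt_add_one ‖u‖))
    filter_upwards [self_mem_nhdsWithin, h1] with v hv hv1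
    refine Eventually.of_forall fun x hx => ?_
    rw [uIoc_of_le zero_le_one] at hx
    rw [norm_mul]
    have := norm_timeDensity_le_one (smul_mem_sepClosedRegion hv (Ioc_subset_Icc_self hx))
    nlinarith [norm_nonneg v, norm_nonneg (timeDensity (x * v))]
  · refine Eventually.of_forall fun x hx => ?_
    rw [uIoc_of_le zero_le_one] at hx
    refine continuousWithinAt_id.mul ?_
    refine ContinuousWithinAt.comp (t := sepClosedRegion) (f := fun v : ℂ => (x : ℂ) * v)
      (continuousOn_timeDensity _ (smul_mem_sepClosedRegion hu (Ioc_subset_Icc_self hx)))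
      (by fun_prop) ?_
    exact fun v hv => smul_mem_sepClosedRegion hv (Ioc_subset_Icc_self hx)

theorem conj_mem_sepClosedRegion {u : ℂ} :
    starRingEnd ℂ u ∈ sepClosedRegion ↔ u ∈ sepClosedRegion := by
  simp [mem_sepClosedRegion]

theorem conj_mem_sepRegion {u : ℂ} : starRingEnd ℂ u ∈ sepRegion ↔ u ∈ sepRegion := by
  simp [mem_sepRegion]

theorem neg_mem_sepClosedRegion {u : ℂ} : -u ∈ sepClosedRegion ↔ u ∈ sepClosedRegion := by
  simp [mem_sepClosedRegion]

theorem mem_timeDomain_of_mem_sepClosedRegion {u : ℂ} (hu : u ∈ sepClosedRegion)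
    (h : sepZ u ≠ 0) : u ∈ timeDomain := by
  have : u ∈ timeDomain ∨ sepZ u = 0 := by
    rw [timeDomain, mem_ofPred_eq, mem_slitPlane_iff]
    by_contra! hcon
    have h1 : (sepZ u).re = 0 := le_antisymm hcon.1.1 hu
    exact hcon.2 (Complex.ext h1 hcon.1.2)
  exact this.resolve_right h

theorem timeMap_conj {u : ℂ} (hu : u ∈ sepClosedRegion) :
    timeMap (starRingEnd ℂ u) = starRingEnd ℂ (timeMap u) := by
  have h : ∀ x ∈ uIcc (0 : ℝ) 1, starRingEnd ℂ u * timeDensity (x * starRingEnd ℂ u) =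
      starRingEnd ℂ (u * timeDensity (x * u)) := by
    intro x hx
    rw [uIcc_of_le zero_le_one] at hx
    have h1 : (x : ℂ) * starRingEnd ℂ u = starRingEnd ℂ (x * u) := by simp
    rw [h1, map_mul (starRingEnd ℂ) u]
    congr 1
    by_cases h0 : sepZ (x * u) = 0
    · rw [timeDensity, timeDensity, sepZ_conj, h0]
      simp [densityZ]
    · exact timeDensity_conj
        (mem_timeDomain_of_mem_sepClosedRegion (smul_mem_sepClosedRegion hu hx) h0)
  rw [timeMap, intervalIntegral.integral_congr h, timeMap,
    intervalIntegral.integral_of_le zero_le_one, intervalIntegral.integral_of_le zero_le_one, integral_conj]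

/-- Noshiro and Warschawski: the real part of the derivative is positive on a half plane. -/
theorem injOn_timeMap_re_pos : InjOn timeMap {u : ℂ | 0 < u.re} := by
  intro u hu v hv huv
  by_contra hne
  have hd : v - u ≠ 0 := sub_ne_zero.mpr (Ne.symm hne)
  set γ : ℝ → ℂ := fun x => u + x * (v - u) with hγ
  have hmem : ∀ x ∈ Icc (0 : ℝ) 1, γ x ∈ timeDomain := by
    intro x hx
    rw [mem_timeDomain_iff]
    left
    have hu' : 0 < u.re := hu
    have hv' : 0 < v.re := hv
    simp only [hγ, add_re, re_ofReal_mul, sub_re]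
    have : 0 < (1 - x) * u.re + x * v.re := by
      rcases eq_or_lt_of_le hx.1 with h | h
      · simp [← h, hu']
      · have := mul_pos h hv'
        have := mul_nonneg (sub_nonneg.mpr hx.2) hu'.le
        linarith
    apply ne_of_gt
    linarith
  -- Dividing by v - u turns the derivative along the segment into the density itself, whose real
  -- part is positive; equal values at both ends are then impossible.
  have hder : ∀ x ∈ Icc (0 : ℝ) 1, HasDerivAt (fun x => (timeMap (γ x) / (v - u)).re)
      (timeDensity (γ x)).re x := by
    intro x hx
    have h2 : HasDerivAt γ (v - u) x := by
      simpa [hγ] using (((hasDerivAt_id x).ofReal_comp.mul_const (v - u)).const_add u)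
    have h3 := ((hasDerivAt_timeMap (hmem x hx)).comp x h2).div_const (v - u)
    rw [mul_div_assoc, div_self hd, mul_one] at h3
    exact reCLM.hasFDerivAt.comp_hasDerivAt x h3
  have hmono : StrictMonoOn (fun x => (timeMap (γ x) / (v - u)).re) (Icc 0 1) := by
    refine strictMonoOn_of_deriv_pos (convex_Icc 0 1)
      (fun x hx => (hder x hx).continuousAt.continuousWithinAt) fun x hx => ?_
    rw [interior_Icc] at hx
    rw [(hder x (Ioo_subset_Icc_self hx)).deriv]
    exact timeDensity_re_pos (hmem x (Ioo_subset_Icc_self hx))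
  have h01 := hmono (left_mem_Icc.mpr zero_le_one) (right_mem_Icc.mpr zero_le_one) zero_lt_one
  simp [hγ, huv] at h01

end TimeMap

/-! ### Images of the imaginary axis and of the hyperbola; injectivity on the region -/

section TimeMapGeometry

open Complex

theorem hasDerivAt_timeMap_comp {γ : ℝ → ℂ} {γ' : ℂ} {x : ℝ} (hγ : HasDerivAt γ γ' x)
    (hx : γ x ∈ timeDomain) :
    HasDerivAt (fun x => timeMap (γ x)) (timeDensity (γ x) * γ') x :=
  (hasDerivAt_timeMap hx).comp x hγ

theorem hasDerivAt_timeMap_comp_re {γ : ℝ → ℂ} {γ' : ℂ} {x : ℝ} (hγ : HasDerivAt γ γ' x)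
    (hx : γ x ∈ timeDomain) :
    HasDerivAt (fun x => (timeMap (γ x)).re) (timeDensity (γ x) * γ').re x :=
  reCLM.hasFDerivAt.comp_hasDerivAt x (hasDerivAt_timeMap_comp hγ hx)

theorem hasDerivAt_timeMap_comp_im {γ : ℝ → ℂ} {γ' : ℂ} {x : ℝ} (hγ : HasDerivAt γ γ' x)
    (hx : γ x ∈ timeDomain) :
    HasDerivAt (fun x => (timeMap (γ x)).im) (timeDensity (γ x) * γ').im x :=
  imCLM.hasFDerivAt.comp_hasDerivAt x (hasDerivAt_timeMap_comp hγ hx)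

theorem timeDensity_imag {y : ℝ} (hy : y ^ 2 ≤ sepN) :
    timeDensity (y * I) = (4 / √21 * (√(sepN - y ^ 2) /
      (√(2 * (sepN - y ^ 2) + 1) * √(sepN - y ^ 2 + sepM))) : ℝ) := by
  rw [timeDensity, ← densityZ_ofReal (by linarith)]
  congr 1
  rw [sepZ, mul_pow, I_sq]
  push_cast
  ring

/-- Between the corners z is real and nonnegative, so the density is real and the radial integrand
purely imaginary. -/
theorem timeMap_imag_re {y : ℝ} (hy : y ^ 2 ≤ sepN) : (timeMap (y * I)).re = 0 := by
  have h : ∀ x ∈ uIcc (0 : ℝ) 1, (y * I : ℂ) * timeDensity (x * (y * I)) =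
      ((y * (4 / √21 * (√(sepN - (x * y) ^ 2) /
      (√(2 * (sepN - (x * y) ^ 2) + 1) * √(sepN - (x * y) ^ 2 + sepM)))) : ℝ) : ℂ) * I := by
    intro x hx
    rw [uIcc_of_le zero_le_one] at hx
    have hx2 : (x * y) ^ 2 ≤ sepN := by
      rw [mul_pow]
      nlinarith [sq_nonneg y, mul_nonneg hx.1 (sub_nonneg.mpr hx.2), sq_nonneg x, hx.1, hx.2]
    rw [← mul_assoc (x : ℂ), ← ofReal_mul, timeDensity_imag hx2]
    push_cast
    ring
  rw [timeMap, intervalIntegral.integral_congr h, intervalIntegral.integral_mul_const,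
    intervalIntegral.integral_ofReal]
  simp

theorem imag_mem_sepClosedRegion {y : ℝ} (hy : y ^ 2 ≤ sepN) : (y * I : ℂ) ∈ sepClosedRegion := by
  rw [mem_sepClosedRegion]; simpa using hy

theorem hasDerivAt_timeMap_imag {y : ℝ} (hy : y ^ 2 < sepN) :
    HasDerivAt (fun y : ℝ => (timeMap (y * I)).im) (timeDensity (y * I)).re y := by
  have hmem : (y * I : ℂ) ∈ timeDomain := by
    rw [mem_timeDomain_iff]; right; simpa using hy
  have h1 : HasDerivAt (fun y : ℝ => (y * I : ℂ)) I y := by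
    simpa using (hasDerivAt_id y).ofReal_comp.mul_const I
  have := hasDerivAt_timeMap_comp_im h1 hmem
  simpa using this

theorem strictMonoOn_timeMap_imag :
    StrictMonoOn (fun y : ℝ => (timeMap (y * I)).im) (Icc (-√sepN) √sepN) := by
  refine strictMonoOn_of_deriv_pos (convex_Icc _ _) ?_ fun y hy => ?_
  · refine continuous_im.comp_continuousOn (continuousOn_timeMap.comp (by fun_prop) fun y hy => ?_)
    exact imag_mem_sepClosedRegion (Real.sq_le sepN_pos.le |>.mpr hy)
  · rw [interior_Icc] at hy
    have h2 : y ^ 2 < sepN := by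
      rw [← sq_sqrt_sepN]; exact sq_lt_sq' hy.1 hy.2
    rw [(hasDerivAt_timeMap_imag h2).deriv]
    apply timeDensity_re_pos
    rw [mem_timeDomain_iff]; right; simpa using h2

/-- The height of the singularity. -/
noncomputable def cornerHeight : ℝ := (timeMap sepCorner).im

theorem timeMap_sepCorner : timeMap sepCorner = cornerHeight * I := by
  refine Complex.ext ?_ (by simp [cornerHeight])
  rw [sepCorner, timeMap_imag_re sq_sqrt_sepN.le]
  simp

theorem cornerHeight_pos : 0 < cornerHeight := by
  have := strictMonoOn_timeMap_imag (a := 0) ⟨by simp, by simp⟩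
    (b := √sepN) ⟨by linarith [sqrt_sepN_pos], le_rfl⟩ sqrt_sepN_pos
  rw [cornerHeight, sepCorner]
  simpa [timeMap_zero] using this

/-- The right upper quarter of the boundary of `sepRegion`. -/
noncomputable def boundaryCurve (x : ℝ) : ℂ := x + √(x ^ 2 + sepN) * I

theorem boundaryCurve_re (x : ℝ) : (boundaryCurve x).re = x := by simp [boundaryCurve]

theorem boundaryCurve_im (x : ℝ) : (boundaryCurve x).im = √(x ^ 2 + sepN) := by
  simp [boundaryCurve]

theorem boundaryCurve_im_sq (x : ℝ) : (boundaryCurve x).im ^ 2 = x ^ 2 + sepN := by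
  rw [boundaryCurve_im, Real.sq_sqrt (add_nonneg (sq_nonneg x) sepN_pos.le)]

theorem boundaryCurve_mem (x : ℝ) : boundaryCurve x ∈ sepClosedRegion := by
  rw [mem_sepClosedRegion, boundaryCurve_re, boundaryCurve_im_sq]
  linarith

theorem boundaryCurve_zero : boundaryCurve 0 = sepCorner := by
  simp [boundaryCurve, sepCorner]

/-- The phase estimate for the velocity of time along the boundary curve. -/
theorem timeDensity_mul_conj_pos {u : ℂ} (h1 : 0 < u.re) (h2 : 0 < u.im)
    (h3 : u.im ^ 2 = u.re ^ 2 + sepN) :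
    0 < (timeDensity u * (starRingEnd ℂ u)).re ∧ (timeDensity u * (starRingEnd ℂ u)).im < 0 := by
  set h := u.re * u.im with hh
  have hpos : 0 < h := mul_pos h1 h2
  have hz : sepZ u = (2 * h : ℝ) * I := by
    refine Complex.ext ?_ ?_
    · rw [sepZ_re]; simp; linarith
    · rw [sepZ_im]; simp [hh]; ring
  have him : 0 < (sepZ u).im := by rw [hz]; simpa using hpos
  have hre : (sepZ u).re = 0 := by rw [hz]; simp
  have him' : (sepZ u).im = 2 * h := by rw [hz]; simp
  have hsl : sepZ u ∈ slitPlane := mem_slitPlane_iff.mpr (Or.inr him.ne')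
  have hsl2 := two_mul_add_one_mem_slitPlane hsl
  have hsl3 := add_sepM_mem_slitPlane hsl
  have him2 : 0 < (2 * sepZ u + 1).im := by simpa using him
  have him3 : 0 < (sepZ u + sepM).im := by simpa using him
  have p1 := re_sqrt_pos hsl
  have p2 := im_sqrt_pos him
  have pq := re_mul_self_sqrt (sepZ u)
  have r1 := re_sqrt_pos hsl2
  have r2 := im_sqrt_pos him2
  have rq := re_mul_self_sqrt (2 * sepZ u + 1)
  have s1 := re_sqrt_pos hsl3
  have s2 := im_sqrt_pos him3
  have sq1 := re_mul_self_sqrt (sepZ u + sepM)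
  have sq2 := im_mul_self_sqrt (sepZ u + sepM)
  rw [hre] at pq
  simp only [add_re, mul_re, re_ofNat, im_ofNat, one_re, hre, ofReal_re] at rq sq1
  simp only [add_im, ofReal_im, him'] at sq2
  have hprod : timeDensity u * starRingEnd ℂ u = (4 / √21 : ℝ) *
      ((sepZ u).sqrt * starRingEnd ℂ u / ((2 * sepZ u + 1).sqrt * (sepZ u + sepM).sqrt)) := by
    rw [timeDensity, densityZ]; ring
  set p := (sepZ u).sqrt
  set r := (2 * sepZ u + 1).sqrt
  set s := (sepZ u + sepM).sqrt
  have hr0 : r ≠ 0 := sqrt_ne_zero' hsl2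
  have hs0 : s ≠ 0 := sqrt_ne_zero' hsl3
  have hNS : 0 < normSq (r * s) := normSq_pos.mpr (mul_ne_zero hr0 hs0)
  -- On the hyperbola z is purely imaginary, so arg √z = π/4.
  have hpe : p.re = p.im := by nlinarith
  have hrr : r.im < r.re := by nlinarith
  have hm := sepM_pos
  have hnm := sepN_lt_sepM
  have hn := sepN_pos
  -- the product `u * s` lies in the first quadrant
  have husim : 0 < u.re * s.im + u.im * s.re := by positivity
  have husre : 0 < u.re * s.re - u.im * s.im := by
    -- Half the imaginary part of (u s)² = (z - N)(z + M) at z = 2ih.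
    have key : (u.re * s.re - u.im * s.im) * (u.re * s.im + u.im * s.re) = h * (sepM - sepN) := by
      have e1 : s.re * s.im = h := by linarith
      have e2 : s.re ^ 2 - s.im ^ 2 = sepM := by linarith
      have e3 : u.re ^ 2 - u.im ^ 2 = -sepN := by linarith
      calc (u.re * s.re - u.im * s.im) * (u.re * s.im + u.im * s.re)
          = (u.re ^ 2 - u.im ^ 2) * (s.re * s.im) + (u.re * u.im) * (s.re ^ 2 - s.im ^ 2) := by ring
        _ = h * (sepM - sepN) := by rw [e1, e2, e3, ← hh]; ring
    have : 0 < h * (sepM - sepN) := mul_pos hpos (by linarith)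
    rw [← key] at this
    exact (pos_iff_pos_of_mul_pos this).mpr husim
  -- The phase is π/4 - arg r - arg(u s) with arg r in (0, π/4) and arg(u s) in (0, π/2), hence a
  -- positive real part. Regrouped as (π/4 - arg u) - arg(r s), with arg u > π/4, it gives a
  -- negative imaginary part.
  have hphase : p * starRingEnd ℂ u / (r * s) =
      ((p * starRingEnd ℂ r) * starRingEnd ℂ (u * s)) / (normSq (r * s) : ℝ) := by
    rw [← mul_conj, map_mul, map_mul]
    have c1 : starRingEnd ℂ r ≠ 0 := by simpa using hr0
    have c2 : starRingEnd ℂ s ≠ 0 := by simpa using hs0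
    field_simp
  rw [hprod, hphase, re_ofReal_mul, im_ofReal_mul, div_ofReal_re, div_ofReal_im]
  have hc := four_div_sqrt_pos
  simp only [mul_re, mul_im, conj_re, conj_im, hpe]
  constructor
  · refine mul_pos hc (div_pos ?_ hNS)
    have : 0 < p.im * ((r.re + r.im) * (u.re * s.re - u.im * s.im) +
        (r.re - r.im) * (u.re * s.im + u.im * s.re)) := by
      have : 0 < r.re - r.im := by linarith
      positivity
    linear_combination this
  · refine mul_neg_of_pos_of_neg hc (div_neg_of_neg_of_pos ?_ hNS)
    have hur : u.re < u.im := by nlinarith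
    have hss : s.im < s.re := by nlinarith
    have : 0 < p.im * ((u.im - u.re) * (r.re * s.re - r.im * s.im) +
        (u.re + u.im) * (r.re * s.im + r.im * s.re)) := by
      have h4 : 0 < u.im - u.re := by linarith
      have h5 : 0 < r.re * s.re - r.im * s.im := by
        have := mul_lt_mul hrr hss.le s2 r1.le
        linarith
      positivity
    linear_combination this

theorem hasDerivAt_boundaryCurve (x : ℝ) :
    HasDerivAt boundaryCurve (1 + (x / √(x ^ 2 + sepN) : ℝ) * I) x := by
  have hpos : 0 < x ^ 2 + sepN := add_pos_of_nonneg_of_pos (sq_nonneg x) sepN_pos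
  have h1 : HasDerivAt (fun x : ℝ => √(x ^ 2 + sepN)) (x / √(x ^ 2 + sepN)) x := by
    have := ((hasDerivAt_pow 2 x).add_const sepN).sqrt hpos.ne'
    convert this using 1
    have := (Real.sqrt_pos.mpr hpos).ne'
    field_simp
    norm_num [mul_comm]
  exact (hasDerivAt_id x).ofReal_comp.add (h1.ofReal_comp.mul_const I)

/-- The tangent 1 + i x/y at u = x + iy equals i ū / y, so the velocity of time is i/y times the
product estimated in `timeDensity_mul_conj_pos`. -/
theorem boundaryCurve_velocity {x : ℝ} (hx : 0 < x) :
    0 < (timeDensity (boundaryCurve x) * (1 + (x / √(x ^ 2 + sepN) : ℝ) * I)).re ∧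
    0 < (timeDensity (boundaryCurve x) * (1 + (x / √(x ^ 2 + sepN) : ℝ) * I)).im := by
  have hpos : 0 < √(x ^ 2 + sepN) :=
    Real.sqrt_pos.mpr (add_pos_of_nonneg_of_pos (sq_nonneg x) sepN_pos)
  have hi := boundaryCurve_im x
  have hr := boundaryCurve_re x
  obtain ⟨h1, h2⟩ := timeDensity_mul_conj_pos (u := boundaryCurve x) (by rwa [hr]) (by rwa [hi])
    (by rw [boundaryCurve_im_sq, hr])
  set f := timeDensity (boundaryCurve x)
  simp only [mul_re, mul_im, conj_re, conj_im, hr, hi] at h1 h2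
  simp only [mul_re, mul_im, add_re, add_im, one_re, one_im, ofReal_re, ofReal_im, I_re, I_im]
  set y := √(x ^ 2 + sepN)
  constructor
  · have : 0 < -(f.re * -y + f.im * x) / y := div_pos (by linarith) hpos
    convert this using 1
    field_simp
    ring
  · have : 0 < (f.re * x - f.im * -y) / y := div_pos h1 hpos
    convert this using 1
    field_simp
    ring

theorem boundaryCurve_mem_timeDomain {x : ℝ} (hx : 0 < x) : boundaryCurve x ∈ timeDomain := by
  rw [mem_timeDomain_iff]; left; rw [boundaryCurve_re]; exact hx.ne'

theorem continuous_boundaryCurve : Continuous boundaryCurve := by unfold boundaryCurve; fun_prop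

theorem boundaryCurve_timeMap {x : ℝ} (hx : 0 < x) :
    0 < (timeMap (boundaryCurve x)).re ∧ cornerHeight < (timeMap (boundaryCurve x)).im := by
  have hc : ContinuousOn (fun x => timeMap (boundaryCurve x)) (Ici 0) :=
    continuousOn_timeMap.comp continuous_boundaryCurve.continuousOn fun x _ => boundaryCurve_mem x
  constructor
  · have hm : StrictMonoOn (fun x => (timeMap (boundaryCurve x)).re) (Ici 0) := by
      refine strictMonoOn_of_deriv_pos (convex_Ici _) (continuous_re.comp_continuousOn hc)
        fun t ht => ?_
      rw [interior_Ici] at ht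
      rw [(hasDerivAt_timeMap_comp_re (hasDerivAt_boundaryCurve t)
        (boundaryCurve_mem_timeDomain ht)).deriv]
      exact (boundaryCurve_velocity ht).1
    have := hm (self_mem_Ici) (mem_Ici.mpr hx.le) hx
    simpa [boundaryCurve_zero, timeMap_sepCorner] using this
  · have hm : StrictMonoOn (fun x => (timeMap (boundaryCurve x)).im) (Ici 0) := by
      refine strictMonoOn_of_deriv_pos (convex_Ici _) (continuous_im.comp_continuousOn hc)
        fun t ht => ?_
      rw [interior_Ici] at ht
      rw [(hasDerivAt_timeMap_comp_im (hasDerivAt_boundaryCurve t)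
        (boundaryCurve_mem_timeDomain ht)).deriv]
      exact (boundaryCurve_velocity ht).2
    have := hm (self_mem_Ici) (mem_Ici.mpr hx.le) hx
    simpa [boundaryCurve_zero, timeMap_sepCorner] using this

theorem timeMap_re_strictMonoOn_horizontal {x₀ y : ℝ} (hx₀ : 0 ≤ x₀)
    (h : y ^ 2 ≤ sepN + x₀ ^ 2) :
    StrictMonoOn (fun x : ℝ => (timeMap (x + y * I)).re) (Ici x₀) := by
  refine strictMonoOn_of_deriv_pos (convex_Ici _) ?_ fun t ht => ?_
  · refine continuous_re.comp_continuousOn (continuousOn_timeMap.comp (by fun_prop) fun x hx => ?_)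
    rw [mem_sepClosedRegion]
    have : x₀ ≤ x := hx
    simp
    nlinarith
  · rw [interior_Ici] at ht
    have ht : x₀ < t := ht
    have hmem : (t + y * I : ℂ) ∈ timeDomain := by
      rw [mem_timeDomain_iff]; left; simp; linarith
    have h1 : HasDerivAt (fun x : ℝ => (x + y * I : ℂ)) 1 t := by
      simpa using (hasDerivAt_id t).ofReal_comp.add_const (y * I : ℂ)
    rw [(hasDerivAt_timeMap_comp_re h1 hmem).deriv, mul_one]
    exact timeDensity_re_pos hmem

/-- Re t increases to the right along horizontal lines. Moving left from u, one meets either the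
imaginary axis, where Re t = 0, or the hyperbola, where Re t is already positive off the corner. -/
theorem timeMap_re_pos_of_im_nonneg {u : ℂ} (hu : u ∈ sepClosedRegion) (hre : 0 < u.re)
    (him : 0 ≤ u.im) : 0 < (timeMap u).re := by
  rw [mem_sepClosedRegion] at hu
  rcases le_total (u.im ^ 2) sepN with h | h
  · have := timeMap_re_strictMonoOn_horizontal (x₀ := 0) (y := u.im) le_rfl (by simpa using h)
      self_mem_Ici (mem_Ici.mpr hre.le) hre
    simp only [ofReal_zero, zero_add, timeMap_imag_re h, re_add_im] at this
    exact this
  · set x₀ := √(u.im ^ 2 - sepN) with hx₀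
    have hs : x₀ ^ 2 = u.im ^ 2 - sepN := Real.sq_sqrt (by linarith)
    have hle : x₀ ≤ u.re := by
      apply le_of_sq_le_sq _ hre.le
      linarith
    have hb : (x₀ + u.im * I : ℂ) = boundaryCurve x₀ := by
      rw [boundaryCurve, hs, sub_add_cancel, Real.sqrt_sq him]
    have hm := (timeMap_re_strictMonoOn_horizontal (x₀ := x₀) (y := u.im) (Real.sqrt_nonneg _)
      (by linarith))
    rcases (Real.sqrt_nonneg (u.im ^ 2 - sepN)).eq_or_lt with h0 | h0
    · have h0' : x₀ = 0 := h0.symm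
      have := hm self_mem_Ici (mem_Ici.mpr hle) (by rwa [h0'])
      simp only [hb, re_add_im] at this
      rw [h0', boundaryCurve_zero, timeMap_sepCorner] at this
      simpa using this
    · have := hm.monotoneOn self_mem_Ici (mem_Ici.mpr hle) hle
      simp only [hb, re_add_im] at this
      exact (boundaryCurve_timeMap h0).1.trans_le this

theorem timeMap_re_pos {u : ℂ} (hu : u ∈ sepClosedRegion) (hre : 0 < u.re) :
    0 < (timeMap u).re := by
  rcases le_total 0 u.im with h | h
  · exact timeMap_re_pos_of_im_nonneg hu hre h
  · have := timeMap_re_pos_of_im_nonneg (conj_mem_sepClosedRegion.mpr hu) (by simpa using hre)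
      (by simpa using h)
    rwa [timeMap_conj hu, conj_re] at this

theorem timeMap_re_neg {u : ℂ} (hu : u ∈ sepClosedRegion) (hre : u.re < 0) :
    (timeMap u).re < 0 := by
  have := timeMap_re_pos (neg_mem_sepClosedRegion.mpr hu) (by simpa using hre)
  rwa [timeMap_neg, neg_re, neg_pos] at this

theorem eq_im_mul_I_of_re_eq_zero {u : ℂ} (h : u.re = 0) : u = (u.im : ℂ) * I :=
  Complex.ext (by simp [h]) (by simp)

theorem timeMap_re_eq_zero_iff {u : ℂ} (hu : u ∈ sepClosedRegion) :
    (timeMap u).re = 0 ↔ u.re = 0 := by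
  constructor
  · intro h
    rcases lt_trichotomy u.re 0 with h' | h' | h'
    · exact absurd h (timeMap_re_neg hu h').ne
    · exact h'
    · exact absurd h (timeMap_re_pos hu h').ne'
  · intro h
    rw [eq_im_mul_I_of_re_eq_zero h, timeMap_imag_re]
    simpa [h] using mem_sepClosedRegion.mp hu

/-- The sign of Re t equals the sign of Re u, which separates the two half planes and the imaginary
axis; each is then handled alone, the axis by monotonicity of Im t. -/
theorem injOn_timeMap : InjOn timeMap sepRegion := by
  intro u hu v hv huv
  have hu' := sepRegion_subset_sepClosedRegion hu
  have hv' := sepRegion_subset_sepClosedRegion hv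
  rcases lt_trichotomy u.re 0 with h | h | h
  · have h1 := timeMap_re_neg hu' h
    have h2 : v.re < 0 := by
      by_contra! hcon
      rcases hcon.eq_or_lt with h3 | h3
      · rw [huv, (timeMap_re_eq_zero_iff hv').mpr h3.symm] at h1
        exact lt_irrefl _ h1
      · rw [huv] at h1
        exact lt_asymm h1 (timeMap_re_pos hv' h3)
    apply neg_injective
    exact injOn_timeMap_re_pos (show 0 < (-u).re by simpa using h)
      (show 0 < (-v).re by simpa using h2) (by rw [timeMap_neg, timeMap_neg, huv])
  · have h2 : v.re = 0 := by
      rw [← timeMap_re_eq_zero_iff hv', ← huv, timeMap_re_eq_zero_iff hu', h]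
    rw [eq_im_mul_I_of_re_eq_zero h, eq_im_mul_I_of_re_eq_zero h2] at huv ⊢
    congr 2
    refine strictMonoOn_timeMap_imag.injOn ?_ ?_ (congrArg im huv)
    · exact (Real.sq_le sepN_pos.le).mp (by simpa [h] using mem_sepClosedRegion.mp hu')
    · exact (Real.sq_le sepN_pos.le).mp (by simpa [h2] using mem_sepClosedRegion.mp hv')
  · have h1 := timeMap_re_pos hu' h
    have h2 : 0 < v.re := by
      by_contra! hcon
      rcases hcon.eq_or_lt with h3 | h3
      · rw [huv, (timeMap_re_eq_zero_iff hv').mpr h3] at h1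
        exact lt_irrefl _ h1
      · rw [huv] at h1
        exact lt_asymm h1 (timeMap_re_neg hv' h3)
    exact injOn_timeMap_re_pos h h2 huv

theorem abs_im_timeMap_lt {u : ℂ} (hu : u ∈ sepRegion) (h : u.re = 0) :
    |(timeMap u).im| < cornerHeight := by
  have h1 : u.im ^ 2 < sepN := by simpa [h] using mem_sepRegion.mp hu
  obtain ⟨h2, h3⟩ := (Real.sq_lt).mp h1
  have hm := strictMonoOn_timeMap_imag
  have hs := sqrt_sepN_pos
  have e1 := hm ⟨h2.le, h3.le⟩ (right_mem_Icc.mpr (by linarith)) h3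
  have e2 := hm (left_mem_Icc.mpr (by linarith)) ⟨h2.le, h3.le⟩ h2
  have e3 : timeMap ((-√sepN : ℝ) * I) = -timeMap sepCorner := by
    rw [← timeMap_neg, sepCorner]; simp
  simp only [e3, ← eq_im_mul_I_of_re_eq_zero h] at e1 e2
  rw [abs_lt]
  exact ⟨by simpa [cornerHeight] using e2, e1⟩

/-- On the boundary of the region the time leaves the strip except at the two corners. -/
theorem cornerHeight_lt_abs_im_timeMap {u : ℂ} (hu : u ∈ sepClosedRegion) (hu' : u ∉ sepRegion)
    (h : u.re ≠ 0) : cornerHeight < |(timeMap u).im| := by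
  have heq : u.im ^ 2 = u.re ^ 2 + sepN := by
    rw [mem_sepClosedRegion] at hu
    rw [mem_sepRegion] at hu'
    linarith
  have key : ∀ v : ℂ, 0 < v.re → 0 ≤ v.im → v.im ^ 2 = v.re ^ 2 + sepN →
      cornerHeight < |(timeMap v).im| := by
    intro v h1 h2 h3
    have : v = boundaryCurve v.re := by
      rw [boundaryCurve, ← h3, Real.sqrt_sq h2, re_add_im]
    rw [this]
    exact (boundaryCurve_timeMap h1).2.trans_le (le_abs_self _)
  have key2 : ∀ v : ℂ, v ∈ sepClosedRegion → 0 < v.re → v.im ^ 2 = v.re ^ 2 + sepN →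
      cornerHeight < |(timeMap v).im| := by
    intro v hv h1 h3
    rcases le_total 0 v.im with h | h
    · exact key v h1 h h3
    · have := key (starRingEnd ℂ v) (by simpa using h1) (by simpa using h) (by simpa using h3)
      rwa [timeMap_conj hv, conj_im, abs_neg] at this
  rcases lt_or_gt_of_ne h with h | h
  · have := key2 (-u) (neg_mem_sepClosedRegion.mpr hu) (by simpa using h) (by simpa using heq)
    rwa [timeMap_neg, neg_im, abs_neg] at this
  · exact key2 u hu h heq

theorem eq_sepCorner_or {u : ℂ} (hu : u ∈ sepClosedRegion) (hu' : u ∉ sepRegion)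
    (h : u.re = 0) : u = sepCorner ∨ u = -sepCorner := by
  have heq : u.im ^ 2 = √sepN ^ 2 := by
    rw [mem_sepClosedRegion, h] at hu
    rw [mem_sepRegion, h] at hu'
    rw [sq_sqrt_sepN]
    linarith
  rw [eq_im_mul_I_of_re_eq_zero h, sepCorner]
  rcases sq_eq_sq_iff_eq_or_eq_neg.mp heq with h1 | h1
  · left; rw [h1]
  · right; rw [h1]; simp

end TimeMapGeometry

/-! ### Properness of the time map and its inverse on the strip -/

section TimeMapInverse

open Complex

theorem sepZ_ofReal (x : ℝ) : sepZ x = ((sepN + x ^ 2 : ℝ) : ℂ) := by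
  rw [sepZ]; push_cast; rfl

theorem sepN_add_sq_pos (x : ℝ) : 0 < sepN + x ^ 2 :=
  add_pos_of_pos_of_nonneg sepN_pos (sq_nonneg x)

theorem ofReal_mem_sepRegion (x : ℝ) : (x : ℂ) ∈ sepRegion := by
  rw [mem_sepRegion]; simpa using sepN_add_sq_pos x

/-- The real velocity of time on the real axis. -/
noncomputable def realDensity (x : ℝ) : ℝ :=
  4 / √21 * (√(sepN + x ^ 2) / (√(2 * (sepN + x ^ 2) + 1) * √(sepN + x ^ 2 + sepM)))

theorem timeDensity_ofReal (x : ℝ) : timeDensity x = (realDensity x : ℝ) := by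
  rw [timeDensity, sepZ_ofReal, densityZ_ofReal (sepN_add_sq_pos x).le, realDensity]

theorem realDensity_pos (x : ℝ) : 0 < realDensity x := by
  have := sepN_add_sq_pos x
  have := sepM_pos
  unfold realDensity
  positivity

/-- The time on the real axis. -/
noncomputable def realTime (x : ℝ) : ℝ := (timeMap x).re

theorem timeMap_ofReal (x : ℝ) : timeMap x = (realTime x : ℝ) := by
  have h := timeMap_conj (sepRegion_subset_sepClosedRegion (ofReal_mem_sepRegion x))
  rw [conj_ofReal] at h
  exact (conj_eq_iff_re.mp h.symm).symm

theorem hasDerivAt_realTime (x : ℝ) : HasDerivAt realTime (realDensity x) x := by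
  have h1 : HasDerivAt (fun x : ℝ => (x : ℂ)) 1 x := (hasDerivAt_id x).ofReal_comp
  have := hasDerivAt_timeMap_comp_re h1 (sepRegion_subset_timeDomain (ofReal_mem_sepRegion x))
  rwa [mul_one, timeDensity_ofReal, ofReal_re] at this

theorem realTime_zero : realTime 0 = 0 := by simp [realTime, timeMap_zero]

/-- A lower bound of order 1/(1 + x) makes real time grow at least logarithmically, hence
unboundedly. -/
theorem realDensity_ge {x : ℝ} (hx : 0 ≤ x) :
    4 / √21 * √(sepN / 4) * (1 / (1 + x)) ≤ realDensity x := by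
  have hn := sepN_pos
  have hz := sepN_add_sq_pos x
  have hm := sepM_pos
  rw [realDensity, mul_assoc]
  refine mul_le_mul_of_nonneg_left ?_ four_div_sqrt_pos.le
  rw [← Real.sqrt_mul (by positivity), ← Real.sqrt_div' _ (by positivity)]
  apply Real.le_sqrt_of_sq_le
  rw [mul_pow, Real.sq_sqrt (by positivity), div_pow, one_pow, div_mul_div_comm,
    div_le_div_iff₀ (by positivity) (by positivity)]
  -- The constants 3 and 4/3 of the two bounds multiply to the 4 in `sepN / 4`.
  have h1 : 2 * (sepN + x ^ 2) + 1 ≤ 3 * (1 + x) ^ 2 := by nlinarith [sepN_lt_one]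
  have h2 : sepN * (sepN + x ^ 2 + sepM) ≤ (4 / 3) * (sepN + x ^ 2) := by
    nlinarith [sepM_mul_sepN, sepN_lt_one, sq_nonneg x, sepM_eq]
  have h3 := mul_le_mul h2 h1 (by positivity) (by positivity)
  nlinarith [h3]

theorem exists_log_le_realTime :
    ∃ c > 0, ∀ x : ℝ, 0 ≤ x → c * Real.log (1 + x) ≤ realTime x := by
  refine ⟨4 / √21 * √(sepN / 4), ?_, fun x hx => ?_⟩
  · have := sepN_pos
    positivity
  set c := 4 / √21 * √(sepN / 4)
  have hder : ∀ t : ℝ, 0 ≤ t → HasDerivAt (fun t => realTime t - c * Real.log (1 + t))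
      (realDensity t - c * (1 / (1 + t))) t := by
    intro t ht
    refine (hasDerivAt_realTime t).sub (HasDerivAt.const_mul c ?_)
    exact ((hasDerivAt_id t).const_add 1).log (by positivity)
  have hm : MonotoneOn (fun t => realTime t - c * Real.log (1 + t)) (Ici 0) := by
    refine monotoneOn_of_deriv_nonneg (convex_Ici 0)
      (fun t ht => (hder t ht).continuousAt.continuousWithinAt) (fun t ht => ?_) fun t ht => ?_
    · rw [interior_Ici] at ht
      exact (hder t (le_of_lt ht)).differentiableAt.differentiableWithinAt
    · rw [interior_Ici] at ht
      rw [(hder t (le_of_lt ht)).deriv]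
      exact sub_nonneg.mpr (realDensity_ge (le_of_lt ht))
  have := hm self_mem_Ici (mem_Ici.mpr hx) hx
  simp only [realTime_zero, add_zero, Real.log_one, mul_zero, sub_zero] at this
  linarith

/-- Rotate u to the positive axis along its circle. The real part grows at fixed modulus, so the arc
stays in the closed region; the angle is at most π/2 and |u| times the density at most 2. -/
theorem norm_timeMap_sub_le {u : ℂ} (hu : u ∈ sepClosedRegion) (hre : 0 ≤ u.re) :
    ‖timeMap u - timeMap (‖u‖ : ℝ)‖ ≤ Real.pi := by
  set φ := arg u
  have hφ : |φ| ≤ Real.pi / 2 := abs_arg_le_pi_div_two_iff.mpr hre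
  set γ : ℝ → ℂ := fun s => ‖u‖ * exp (((s * φ : ℝ) : ℂ) * I) with hγ
  have hγ1 : γ 1 = u := by
    simp only [hγ, one_mul]; exact norm_mul_exp_arg_mul_I u
  have hγ0 : γ 0 = (‖u‖ : ℝ) := by simp [hγ]
  have hγn : ∀ s, ‖γ s‖ = ‖u‖ := fun s => by
    rw [hγ, norm_mul, norm_exp_ofReal_mul_I, norm_real, norm_norm, mul_one]
  have hγre : ∀ s, (γ s).re = ‖u‖ * Real.cos (s * φ) := fun s => by
    simp only [hγ, re_ofReal_mul, exp_ofReal_mul_I_re]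
  have hmem : ∀ s ∈ Icc (0 : ℝ) 1, γ s ∈ sepClosedRegion := by
    intro s hs
    rw [mem_sepClosedRegion] at hu ⊢
    have e1 : (γ s).re ^ 2 + (γ s).im ^ 2 = u.re ^ 2 + u.im ^ 2 := by
      have h1 := Complex.sq_norm (γ s)
      have h2 := Complex.sq_norm u
      rw [normSq_apply] at h1 h2
      rw [hγn] at h1
      nlinarith
    have e2 : u.re ≤ (γ s).re := by
      conv_lhs => rw [← hγ1]
      rw [hγre, hγre, one_mul]
      refine mul_le_mul_of_nonneg_left ?_ (norm_nonneg u)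
      rw [← Real.cos_abs φ, ← Real.cos_abs (s * φ)]
      refine Real.cos_le_cos_of_nonneg_of_le_pi (abs_nonneg _) ?_ ?_
      · linarith [Real.pi_pos]
      · rw [abs_mul, abs_of_nonneg hs.1]
        nlinarith [hs.2, abs_nonneg φ]
    nlinarith
  have hder : ∀ s, HasDerivAt γ (γ s * (φ * I)) s := by
    intro s
    have h1 : HasDerivAt (fun s : ℝ => ((s * φ : ℝ) : ℂ) * I) (φ * I) s := by
      have := (((hasDerivAt_id s).mul_const φ).ofReal_comp).mul_const I
      simpa using this
    have h2 := (h1.cexp).const_mul (‖u‖ : ℂ)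
    rw [← mul_assoc] at h2
    exact h2
  -- Derivatives are needed only on [0, 1): the end point s = 1 may be a corner, where only
  -- continuity is known.
  have hbound := norm_image_sub_le_of_norm_deriv_right_le_segment (a := (0 : ℝ)) (b := 1)
    (f := fun s => timeMap (γ s)) (f' := fun s => timeDensity (γ s) * (γ s * (φ * I)))
    (C := Real.pi) ?_ ?_ ?_ 1 (right_mem_Icc.mpr zero_le_one)
  · simpa [hγ1, hγ0] using hbound
  · exact continuousOn_timeMap.comp (HasDerivAt.continuousOn fun s _ => hder s) hmem
  · intro s hs
    by_cases h0 : u = 0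
    · have : γ = fun _ => 0 := by
        funext s; simp [hγ, h0]
      simp only [this, timeMap_zero, zero_mul, mul_zero]
      exact hasDerivWithinAt_const _ _ _
    refine (hasDerivAt_timeMap_comp (hder s) ?_).hasDerivWithinAt
    rw [mem_timeDomain_iff]
    left
    rw [hγre]
    refine (mul_pos (norm_pos_iff.mpr h0) (Real.cos_pos_of_mem_Ioo ?_)).ne'
    rw [mem_Ioo, ← abs_lt, abs_mul, abs_of_nonneg hs.1]
    have := Real.pi_pos
    rcases (abs_nonneg φ).eq_or_lt with h | h
    · rw [← h]; linarith
    · nlinarith [hs.2]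
  · intro s hs
    have h1 := norm_mul_norm_timeDensity_le (hmem s (Ico_subset_Icc_self hs))
    have e : ‖(φ * I : ℂ)‖ = |φ| := by simp
    have e' : ‖γ s * (φ * I)‖ = ‖γ s‖ * |φ| := (norm_mul _ _).trans (by rw [e])
    rw [norm_mul, e']
    calc ‖timeDensity (γ s)‖ * (‖γ s‖ * |φ|) = (‖γ s‖ * ‖timeDensity (γ s)‖) * |φ| := by ring
      _ ≤ 2 * (Real.pi / 2) := mul_le_mul h1 hφ (abs_nonneg _) zero_le_two
      _ = Real.pi := by ring

/-- The time map is proper on the closed region. -/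
theorem exists_norm_le_of_norm_timeMap_le (R : ℝ) :
    ∃ B, ∀ u ∈ sepClosedRegion, ‖timeMap u‖ ≤ R → ‖u‖ ≤ B := by
  obtain ⟨c, hc, h⟩ := exists_log_le_realTime
  refine ⟨Real.exp ((R + Real.pi) / c), ?_⟩
  have key : ∀ u ∈ sepClosedRegion, 0 ≤ u.re → ‖timeMap u‖ ≤ R →
      ‖u‖ ≤ Real.exp ((R + Real.pi) / c) := by
    intro u hu hre hR
    have h1 := norm_timeMap_sub_le hu hre
    have h2 := h ‖u‖ (norm_nonneg u)
    have h3 : realTime ‖u‖ ≤ R + Real.pi := by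
      have : ‖timeMap (‖u‖ : ℝ)‖ ≤ ‖timeMap u‖ + ‖timeMap u - timeMap (‖u‖ : ℝ)‖ := by
        have := norm_sub_le (timeMap u) (timeMap u - timeMap (‖u‖ : ℝ))
        rwa [sub_sub_cancel] at this
      rw [timeMap_ofReal, norm_real] at this
      have h4 := Real.le_norm_self (realTime ‖u‖)
      rw [timeMap_ofReal] at h1
      linarith
    have h4 : Real.log (1 + ‖u‖) ≤ (R + Real.pi) / c := by
      rw [le_div_iff₀ hc]; linarith
    have h5 := (Real.log_le_iff_le_exp (by positivity)).mp h4
    linarith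
  intro u hu hR
  rcases le_total 0 u.re with h' | h'
  · exact key u hu h' hR
  · have := key (-u) (neg_mem_sepClosedRegion.mpr hu) (by simpa using h')
      (by rwa [timeMap_neg, norm_neg])
    rwa [norm_neg] at this

theorem timeMap_eq_of_tendsto {U : Ultrafilter ℂ} {v : ℂ → ℂ} {t : ℂ} (hU : ↑U ≤ 𝓝 t)
    (hv : ∀ᶠ s in U, v s ∈ sepClosedRegion ∧ timeMap (v s) = s) {u : ℂ}
    (hu : Tendsto v U (𝓝 u)) : u ∈ sepClosedRegion ∧ timeMap u = t := by
  have h1 : u ∈ sepClosedRegion :=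
    isClosed_sepClosedRegion.mem_of_tendsto hu (hv.mono fun _ h => h.1)
  refine ⟨h1, ?_⟩
  have h2 : Tendsto v U (𝓝[sepClosedRegion] u) :=
    tendsto_nhdsWithin_iff.mpr ⟨hu, hv.mono fun _ h => h.1⟩
  have h3 : Tendsto (fun s => timeMap (v s)) U (𝓝 (timeMap u)) :=
    Tendsto.comp (continuousOn_timeMap u h1) h2
  have h4 : Tendsto (fun s => timeMap (v s)) U (𝓝 t) :=
    Tendsto.congr' (hv.mono fun s h => h.2.symm) (tendsto_id.mono_left hU)
  exact tendsto_nhds_unique h3 h4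

theorem exists_isCompact_preimage (t : ℂ) :
    ∃ K, IsCompact K ∧ ∀ s ∈ Metric.ball t 1, ∀ u ∈ sepClosedRegion, timeMap u = s → u ∈ K := by
  obtain ⟨B, hB⟩ := exists_norm_le_of_norm_timeMap_le (‖t‖ + 1)
  refine ⟨Metric.closedBall 0 B, isCompact_closedBall 0 B, fun s hs u hu hus => ?_⟩
  rw [mem_closedBall_zero_iff]
  apply hB u hu
  rw [hus]
  have h1 : ‖s - t‖ < 1 := by rwa [← dist_eq_norm]
  have h2 := norm_sub_norm_le s t
  linarith

/-- By properness, preimages of points near t stay in a compact set, and any limit of them is a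
preimage of t in the closed region. -/
theorem exists_timeMap_eq_of_mem_closure {t : ℂ} (ht : t ∈ closure (timeMap '' sepRegion)) :
    ∃ u ∈ sepClosedRegion, timeMap u = t := by
  obtain ⟨U, hUm, hU⟩ := mem_closure_iff_ultrafilter.mp ht
  obtain ⟨K, hK, hKs⟩ := exists_isCompact_preimage t
  set v := Function.invFunOn timeMap sepRegion
  have hv : ∀ᶠ s in U, v s ∈ sepClosedRegion ∧ timeMap (v s) = s := by
    filter_upwards [hUm] with s hs
    exact ⟨sepRegion_subset_sepClosedRegion (Function.invFunOn_mem hs), Function.invFunOn_eq hs⟩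
  have hvK : ∀ᶠ s in (U : Filter ℂ), v s ∈ K := by
    filter_upwards [hv, hU (Metric.ball_mem_nhds t one_pos)] with s hs hs'
    exact hKs s hs' _ hs.1 hs.2
  obtain ⟨u, -, hu⟩ := hK.ultrafilter_le_nhds (U.map v) (tendsto_principal.mpr hvK)
  exact ⟨u, timeMap_eq_of_tendsto hU hv hu⟩

/-- The closed strip without the two singular points. -/
def timeStrip : Set ℂ := {t : ℂ | |t.im| ≤ cornerHeight} \ {cornerHeight * I, -(cornerHeight * I)}

theorem mem_sepRegion_of_timeMap_mem_timeStrip {u : ℂ} (hu : u ∈ sepClosedRegion)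
    (ht : timeMap u ∈ timeStrip) : u ∈ sepRegion := by
  by_contra hcon
  by_cases h : u.re = 0
  · apply ht.2
    rcases eq_sepCorner_or hu hcon h with h1 | h1
    · rw [h1, timeMap_sepCorner]; simp
    · rw [h1, timeMap_neg, timeMap_sepCorner]; simp
  · exact absurd ht.1 (not_le.mpr (cornerHeight_lt_abs_im_timeMap hu hcon h))

theorem analyticAt_timeMap {u : ℂ} (hu : u ∈ timeDomain) : AnalyticAt ℂ timeMap u := by
  have : DifferentiableOn ℂ timeMap timeDomain := fun v hv =>
    (hasDerivAt_timeMap hv).differentiableAt.differentiableWithinAt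
  exact this.analyticAt (isOpen_timeDomain.mem_nhds hu)

theorem hasStrictDerivAt_timeMap {u : ℂ} (hu : u ∈ timeDomain) :
    HasStrictDerivAt timeMap (timeDensity u) u := by
  have := (analyticAt_timeMap hu).hasStrictDerivAt
  rwa [(hasDerivAt_timeMap hu).deriv] at this

theorem timeMap_image_mem_nhds {u : ℂ} (hu : u ∈ timeDomain) {V : Set ℂ} (hV : V ∈ 𝓝 u) :
    timeMap '' V ∈ 𝓝 (timeMap u) := by
  rw [← (hasStrictDerivAt_timeMap hu).map_nhds_eq (timeDensity_ne_zero hu)]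
  exact image_mem_map hV

theorem isOpen_timeMap_image : IsOpen (timeMap '' sepRegion) := by
  rw [isOpen_iff_mem_nhds]
  rintro _ ⟨u, hu, rfl⟩
  exact timeMap_image_mem_nhds (sepRegion_subset_timeDomain hu) (isOpen_sepRegion.mem_nhds hu)

theorem starConvex_timeStrip : StarConvex ℝ 0 timeStrip := by
  rw [starConvex_zero_iff]
  intro t ht x hx0 hx1
  have hA := cornerHeight_pos
  have him : |(x • t).im| = x * |t.im| := by
    rw [real_smul, im_ofReal_mul, abs_mul, abs_of_nonneg hx0]
  rcases hx1.eq_or_lt with h | h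
  · rwa [h, one_smul]
  have hlt : |(x • t).im| < cornerHeight := by
    rw [him]
    have h1 : |t.im| ≤ cornerHeight := ht.1
    nlinarith [abs_nonneg t.im]
  refine ⟨hlt.le, ?_⟩
  rintro (h1 | h1)
  · rw [h1] at hlt; simp [abs_of_pos hA] at hlt
  · rw [mem_singleton_iff] at h1
    rw [h1] at hlt; simp [abs_of_pos hA] at hlt

theorem zero_mem_timeStrip : (0 : ℂ) ∈ timeStrip := by
  have hA := cornerHeight_pos
  refine ⟨by simpa using hA.le, ?_⟩
  rintro (h | h)
  · have := congrArg im h; simp at this; linarith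
  · have := congrArg im h; simp at this; linarith

theorem isPreconnected_timeStrip : IsPreconnected timeStrip :=
  (starConvex_timeStrip.isPathConnected zero_mem_timeStrip).isConnected.isPreconnected

/-- The image is open, and relatively closed in the strip: a limit point has a preimage in the
closed region, which cannot lie on the boundary since the boundary is sent to ±iA or outside the
closed strip. The punctured strip is connected. -/
theorem timeStrip_subset_image : timeStrip ⊆ timeMap '' sepRegion := by
  refine isPreconnected_timeStrip.subset_of_closure_inter_subset isOpen_timeMap_image
    ⟨0, zero_mem_timeStrip, (0 : ℂ), ?_, timeMap_zero⟩ ?_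
  · exact_mod_cast ofReal_mem_sepRegion 0
  · rintro t ⟨ht1, ht2⟩
    obtain ⟨u, hu, rfl⟩ := exists_timeMap_eq_of_mem_closure ht1
    exact ⟨u, mem_sepRegion_of_timeMap_mem_timeStrip hu ht2, rfl⟩

/-- The inverse of the time map. -/
noncomputable def timeInv : ℂ → ℂ := Function.invFunOn timeMap sepRegion

theorem timeInv_mem {t : ℂ} (ht : t ∈ timeMap '' sepRegion) : timeInv t ∈ sepRegion :=
  Function.invFunOn_mem ht

theorem timeMap_timeInv {t : ℂ} (ht : t ∈ timeMap '' sepRegion) : timeMap (timeInv t) = t :=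
  Function.invFunOn_eq ht

theorem timeInv_timeMap {u : ℂ} (hu : u ∈ sepRegion) : timeInv (timeMap u) = u :=
  injOn_timeMap (timeInv_mem ⟨u, hu, rfl⟩) hu (timeMap_timeInv ⟨u, hu, rfl⟩)

theorem continuousAt_timeInv {t : ℂ} (ht : t ∈ timeMap '' sepRegion) : ContinuousAt timeInv t := by
  obtain ⟨u, hu, rfl⟩ := ht
  rw [ContinuousAt, timeInv_timeMap hu]
  intro V hV
  have h1 := timeMap_image_mem_nhds (sepRegion_subset_timeDomain hu)
    (inter_mem hV (isOpen_sepRegion.mem_nhds hu))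
  rw [mem_map]
  refine mem_of_superset h1 ?_
  rintro _ ⟨v, hv, rfl⟩
  rw [mem_preimage, timeInv_timeMap hv.2]
  exact hv.1

theorem hasDerivAt_timeInv {t : ℂ} (ht : t ∈ timeMap '' sepRegion) :
    HasDerivAt timeInv (timeDensity (timeInv t))⁻¹ t := by
  have hd := sepRegion_subset_timeDomain (timeInv_mem ht)
  refine HasDerivAt.of_local_left_inverse (continuousAt_timeInv ht) (hasDerivAt_timeMap hd)
    (timeDensity_ne_zero hd) ?_
  filter_upwards [isOpen_timeMap_image.mem_nhds ht] with s hs using timeMap_timeInv hs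

theorem analyticAt_timeInv {t : ℂ} (ht : t ∈ timeMap '' sepRegion) : AnalyticAt ℂ timeInv t := by
  have : DifferentiableOn ℂ timeInv (timeMap '' sepRegion) := fun s hs =>
    (hasDerivAt_timeInv hs).differentiableAt.differentiableWithinAt
  exact this.analyticAt (isOpen_timeMap_image.mem_nhds ht)

/-- Near `timeMap c` the inverse takes values in a compact set, and each of its cluster points is a
preimage of `timeMap c`, hence c. -/
theorem tendsto_timeInv_of_unique {c : ℂ}
    (huniq : ∀ u ∈ sepClosedRegion, timeMap u = timeMap c → u = c) :
    Tendsto timeInv (𝓝[timeStrip] (timeMap c)) (𝓝 c) := by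
  obtain ⟨K, hK, hKs⟩ := exists_isCompact_preimage (timeMap c)
  have hv : ∀ᶠ s in 𝓝[timeStrip] (timeMap c),
      timeInv s ∈ sepClosedRegion ∧ timeMap (timeInv s) = s := by
    filter_upwards [self_mem_nhdsWithin] with s hs
    have := timeStrip_subset_image hs
    exact ⟨sepRegion_subset_sepClosedRegion (timeInv_mem this), timeMap_timeInv this⟩
  refine hK.tendsto_nhds_of_unique_mapClusterPt ?_ fun u _ hu => ?_
  · filter_upwards [hv, mem_nhdsWithin_of_mem_nhds (Metric.ball_mem_nhds _ one_pos)] with s hs hs'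
    exact hKs s hs' _ hs.1 hs.2
  · obtain ⟨U, hU, hUu⟩ := mapClusterPt_iff_ultrafilter.mp hu
    obtain ⟨h1, h2⟩ := timeMap_eq_of_tendsto (hU.trans nhdsWithin_le_nhds) (hU hv) hUu
    exact huniq u h1 h2

theorem eq_sepCorner_or_of_timeMap {u : ℂ} (hu : u ∈ sepClosedRegion) (hre : (timeMap u).re = 0)
    (him : |(timeMap u).im| = cornerHeight) : u = sepCorner ∨ u = -sepCorner := by
  have h := (timeMap_re_eq_zero_iff hu).mp hre
  refine eq_sepCorner_or hu (fun hcon => ?_) h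
  exact absurd him (abs_im_timeMap_lt hcon h).ne

theorem tendsto_timeInv_sepCorner :
    Tendsto timeInv (𝓝[timeStrip] (cornerHeight * I)) (𝓝 sepCorner) := by
  have hA := cornerHeight_pos
  rw [← timeMap_sepCorner]
  refine tendsto_timeInv_of_unique fun u hu h => ?_
  rw [timeMap_sepCorner] at h
  rcases eq_sepCorner_or_of_timeMap hu (by simp [h]) (by simp [h, abs_of_pos hA]) with h1 | h1
  · exact h1
  · rw [h1, timeMap_neg, timeMap_sepCorner] at h
    have := congrArg im h
    simp at this
    linarith

theorem tendsto_timeInv_neg_sepCorner :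
    Tendsto timeInv (𝓝[timeStrip] (-(cornerHeight * I))) (𝓝 (-sepCorner)) := by
  have hA := cornerHeight_pos
  rw [← timeMap_sepCorner, ← timeMap_neg]
  refine tendsto_timeInv_of_unique fun u hu h => ?_
  rw [timeMap_neg, timeMap_sepCorner] at h
  rcases eq_sepCorner_or_of_timeMap hu (by simp [h]) (by simp [h, abs_of_pos hA]) with h1 | h1
  · rw [h1, timeMap_sepCorner] at h
    have := congrArg im h
    simp at this
    linarith
  · exact h1

end TimeMapInverse

/-! ### The height of the corner is the integral A -/

section StripWidth

open Complex

theorem aPlus_eq : aPlus = sepN / (1 + sepN) := by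
  rw [eq_div_iff (by linarith [sepN_pos]), aPlus, sepN]
  have := Real.mul_self_sqrt (show (0 : ℝ) ≤ 2 by norm_num)
  linear_combination (1 / 7) * this

theorem aMinus_eq : aMinus = -sepM / (1 - sepM) := by
  rw [eq_div_iff (by linarith [sepM_lt_one]), aMinus, sepM]
  have := Real.mul_self_sqrt (show (0 : ℝ) ≤ 2 by norm_num)
  linear_combination (1 / 7) * this

theorem one_add_sepN_mul_one_sub_sepM : (1 + sepN) * (1 - sepM) = 4 / 7 := by
  linear_combination (-1) * sepM_mul_sepN - sepM_eq

/-- Substitution x = z/(1 + z) with z = N - y², that is u = iy. The factor y of the Jacobian cancels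
the singularity from a₊ - x, which is proportional to y²/(1 + z). -/
theorem strip_integrand_eq {y : ℝ} (hy : 0 < y) (hy2 : y ^ 2 < sepN) :
    2 * y / (1 + (sepN - y ^ 2)) ^ 2 *
      (1 / (1 - (sepN - y ^ 2) / (1 + (sepN - y ^ 2))) *
        √((sepN - y ^ 2) / (1 + (sepN - y ^ 2)) /
          (3 * ((sepN - y ^ 2) / (1 + (sepN - y ^ 2)) + 1) *
            (aPlus - (sepN - y ^ 2) / (1 + (sepN - y ^ 2))) *
            ((sepN - y ^ 2) / (1 + (sepN - y ^ 2)) - aMinus)))) =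
    (timeDensity (y * I)).re := by
  rw [timeDensity_imag hy2.le, ofReal_re]
  obtain ⟨z, hz⟩ : ∃ z, z = sepN - y ^ 2 := ⟨_, rfl⟩
  have hy' : y ^ 2 = sepN - z := by linarith
  have hz0 : 0 < z := by linarith
  have hm := sepM_pos
  have hm1 := sepM_lt_one
  have hn := sepN_pos
  rw [← hz]
  have e1 : aPlus - z / (1 + z) = y ^ 2 / ((1 + sepN) * (1 + z)) := by
    rw [aPlus_eq, hy']
    field_simp
    ring
  have e2 : z / (1 + z) - aMinus = (z + sepM) / ((1 - sepM) * (1 + z)) := by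
    have : 1 - sepM ≠ 0 := by linarith
    rw [aMinus_eq]
    field_simp
    ring
  have e3 : z / (1 + z) + 1 = (2 * z + 1) / (1 + z) := by
    field_simp
    ring
  have e4 : 1 - z / (1 + z) = 1 / (1 + z) := by
    field_simp
    ring
  -- The constant (2/√21)² is (1 + N)(1 - M)/3 = (4/7)/3.
  have e5 : z / (1 + z) / (3 * (z / (1 + z) + 1) * (aPlus - z / (1 + z)) *
      (z / (1 + z) - aMinus)) = (2 / √21 * ((1 + z) / y)) ^ 2 *
        (z / ((2 * z + 1) * (z + sepM))) := by
    have hm1' : 1 - sepM ≠ 0 := by linarith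
    have hk : (1 + sepN) = 4 / 7 / (1 - sepM) := by
      rw [← one_add_sepN_mul_one_sub_sepM]; field_simp
    rw [e1, e2, e3, mul_pow, div_pow 2, Real.sq_sqrt (by norm_num), hk]
    field_simp
    norm_num
  rw [e5, Real.sqrt_mul (by positivity), Real.sqrt_sq (by positivity), e4,
    Real.sqrt_div hz0.le, Real.sqrt_mul (by positivity)]
  field_simp
  norm_num

theorem image_cos_half_angle :
    (fun y : ℝ => (sepN - y ^ 2) / (1 + (sepN - y ^ 2))) '' Ioo 0 √sepN = Ioo 0 aPlus := by
  have hn := sepN_pos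
  ext x
  constructor
  · rintro ⟨y, hy, rfl⟩
    have h1 : y ^ 2 < sepN := by
      rw [← sq_sqrt_sepN]; exact sq_lt_sq' (by linarith [hy.1, hy.2]) hy.2
    have h2 : 0 < y ^ 2 := pow_pos hy.1 2
    refine ⟨div_pos (by linarith) (by linarith), ?_⟩
    rw [aPlus_eq]
    dsimp only
    rw [div_lt_div_iff₀ (by linarith) (by linarith)]
    nlinarith
  · rintro ⟨h0, h1⟩
    rw [aPlus_eq, lt_div_iff₀ (by linarith)] at h1
    have hx1 : x < 1 := by nlinarith
    have hx1' : (1 - x) ≠ 0 := by linarith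
    have h2 : x / (1 - x) < sepN := by
      rw [div_lt_iff₀ (by linarith)]; nlinarith
    have h3 : 0 < x / (1 - x) := div_pos h0 (by linarith)
    refine ⟨√(sepN - x / (1 - x)), ⟨Real.sqrt_pos.mpr (by linarith),
      Real.sqrt_lt_sqrt (by linarith) (by linarith)⟩, ?_⟩
    dsimp only
    rw [Real.sq_sqrt (by linarith), sub_sub_cancel]
    field_simp
    ring

theorem cornerHeight_eq_stripWidth : cornerHeight = stripWidth := by
  have hn := sepN_pos
  have hs := sqrt_sepN_pos
  have hlt : ∀ y ∈ Ioo 0 √sepN, y ^ 2 < sepN := fun y hy => by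
    rw [← sq_sqrt_sepN]; exact sq_lt_sq' (by linarith [hy.1, hy.2]) hy.2
  have haP : 0 < aPlus := by rw [aPlus_eq]; positivity
  have hmem : MapsTo (fun y : ℝ => (y * I : ℂ)) (Icc 0 √sepN) sepClosedRegion := fun y hy =>
    imag_mem_sepClosedRegion ((Real.sq_le hn.le).mpr ⟨by linarith [hy.1], hy.2⟩)
  have h1 : ∫ y in (0 : ℝ)..√sepN, (timeDensity (y * I)).re = cornerHeight := by
    -- This form asks for the derivative only in the open interval, which avoids the branch point at
    -- the corner.
    rw [intervalIntegral.integral_eq_sub_of_hasDerivAt_of_le hs.le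
      (f := fun y : ℝ => (timeMap (y * I)).im)]
    · rw [cornerHeight, sepCorner]; simp [timeMap_zero]
    · exact continuous_im.comp_continuousOn (continuousOn_timeMap.comp (by fun_prop) hmem)
    · exact fun y hy => hasDerivAt_timeMap_imag (hlt y hy)
    · refine ContinuousOn.intervalIntegrable ?_
      rw [uIcc_of_le hs.le]
      exact continuous_re.comp_continuousOn (continuousOn_timeDensity.comp (by fun_prop) hmem)
  rw [← h1, stripWidth, intervalIntegral.integral_of_le hs.le,
    intervalIntegral.integral_of_le haP.le, MeasureTheory.integral_Ioc_eq_integral_Ioo,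
    MeasureTheory.integral_Ioc_eq_integral_Ioo, ← image_cos_half_angle,
    MeasureTheory.integral_image_eq_integral_abs_deriv_smul measurableSet_Ioo
      (f' := fun y => -(2 * y / (1 + (sepN - y ^ 2)) ^ 2))]
  · refine MeasureTheory.setIntegral_congr_fun measurableSet_Ioo fun y hy => ?_
    have := hlt y hy
    rw [abs_neg, abs_of_nonneg (div_nonneg (by linarith [hy.1]) (sq_nonneg _)), smul_eq_mul,
      strip_integrand_eq hy.1 (hlt y hy)]
  · intro y hy
    have h2 := hlt y hy
    have hd : HasDerivAt (fun y : ℝ => sepN - y ^ 2) (-(2 * y)) y := by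
      simpa using (hasDerivAt_pow 2 y).const_sub sepN
    have h3 := hd.div (hd.const_add 1) (by linarith)
    refine (h3.congr_deriv ?_).hasDerivWithinAt
    ring
  · intro y hy y' hy' h
    have h2 := hlt y hy
    have h3 := hlt y' hy'
    dsimp only at h
    rw [div_eq_div_iff (by linarith) (by linarith)] at h
    have h4 : y ^ 2 = y' ^ 2 := by linarith
    exact (pow_left_inj₀ hy.1.le hy'.1.le two_ne_zero).mp h4

theorem stripWidth_pos : 0 < stripWidth := cornerHeight_eq_stripWidth ▸ cornerHeight_pos

theorem puncturedClosedStrip_eq : puncturedClosedStrip = timeStrip := by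
  have hA := stripWidth_pos
  have h1 : openStrip = im ⁻¹' Ioo (-stripWidth) stripWidth := by
    ext t; simp [openStrip, abs_lt]
  have h2 : closure openStrip = {t : ℂ | |t.im| ≤ stripWidth} := by
    rw [h1, closure_preimage_im, closure_Ioo (by linarith)]
    ext t; simp [abs_le]
  rw [puncturedClosedStrip, timeStrip, h2, cornerHeight_eq_stripWidth, mul_comm I]

end StripWidth

/-! ### The complex momentum: zeros, blow-up and uniqueness of the continuation -/

section MomentumMap

open Complex

/-- The momentum as a function of `u`. -/
noncomputable def momentumMap (u : ℂ) : ℂ :=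
  (√21 / 3 : ℝ) * (u / (1 + sepZ u)) * ((sepZ u + sepM).sqrt / (sepZ u).sqrt)

theorem one_add_ne_zero_of_mem_slitPlane {z : ℂ} (hz : z ∈ slitPlane) : 1 + z ≠ 0 := by
  have := add_ofReal_mem_slitPlane hz zero_le_one
  rw [ofReal_one, add_comm] at this
  exact slitPlane_ne_zero this

theorem analyticAt_momentumMap {u : ℂ} (hu : u ∈ timeDomain) : AnalyticAt ℂ momentumMap u := by
  have hz := analyticAt_sepZ u
  have h1 : AnalyticAt ℂ (fun u => (sepZ u).sqrt) u :=
    AnalyticAt.fun_comp (f := sepZ) (analyticAt_sqrt hu) hz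
  have h2 : AnalyticAt ℂ (fun u => (sepZ u + sepM).sqrt) u :=
    AnalyticAt.fun_comp (f := fun u => sepZ u + sepM) (analyticAt_sqrt (add_sepM_mem_slitPlane hu))
      (hz.add analyticAt_const)
  exact (analyticAt_const.mul (analyticAt_id.div (analyticAt_const.add hz)
    (one_add_ne_zero_of_mem_slitPlane hu))).mul (h2.div h1 (sqrt_ne_zero' hu))

theorem momentumMap_eq_zero_iff {u : ℂ} (hu : u ∈ timeDomain) : momentumMap u = 0 ↔ u = 0 := by
  have h1 := sqrt_ne_zero' hu
  have h2 := sqrt_ne_zero' (add_sepM_mem_slitPlane hu)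
  have h3 := one_add_ne_zero_of_mem_slitPlane hu
  have h4 : ((√21 / 3 : ℝ) : ℂ) ≠ 0 := by
    rw [Ne, ofReal_eq_zero]; positivity
  simp only [momentumMap, mul_eq_zero, div_eq_zero_iff, h1, h2, h3, h4, or_false, false_or]

/-- The factor 1/√z diverges while the remaining factors tend to a nonzero multiple of c √M. -/
theorem tendsto_norm_momentumMap {c : ℂ} (hc : sepZ c = 0) :
    Tendsto (fun u => ‖momentumMap u‖) (𝓝[timeDomain] c) atTop := by
  have hc0 : c ≠ 0 := by
    rintro rfl
    simp [sepZ] at hc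
    exact sepN_pos.ne' hc
  have hz : Tendsto sepZ (𝓝 c) (𝓝 0) := hc ▸ continuous_sepZ.continuousAt
  have e : ∀ u, ‖momentumMap u‖ =
      ‖(√21 / 3 : ℝ) * (u / (1 + sepZ u)) * (sepZ u + sepM).sqrt‖ * ‖(sepZ u).sqrt‖⁻¹ := fun u => by
    rw [momentumMap, ← mul_div_assoc, norm_div, div_eq_mul_inv]
  simp only [e]
  have hM : ContinuousAt Complex.sqrt (0 + sepM) :=
    continuousAt_sqrt (Or.inl (by simpa using sepM_pos.le))
  have hMne : (0 + sepM : ℂ).sqrt ≠ 0 :=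
    sqrt_ne_zero' (mem_slitPlane_iff.mpr (Or.inl (by simpa using sepM_pos)))
  have h1 : Tendsto (fun u => ‖(√21 / 3 : ℝ) * (u / (1 + sepZ u)) * (sepZ u + sepM).sqrt‖)
      (𝓝[timeDomain] c) (𝓝 ‖(√21 / 3 : ℝ) * (c / (1 + 0)) * (0 + sepM : ℂ).sqrt‖) := by
    refine Tendsto.mono_left ?_ nhdsWithin_le_nhds
    exact ((tendsto_const_nhds.mul (tendsto_id.div (tendsto_const_nhds.add hz) (by simp))).mul
      (hM.tendsto.comp (hz.add tendsto_const_nhds))).norm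
  refine Tendsto.pos_mul_atTop ?_ h1 (tendsto_inv_nhdsGT_zero.comp ?_)
  · rw [norm_pos_iff]
    refine mul_ne_zero (mul_ne_zero ?_ (by simpa using hc0)) hMne
    rw [Ne, ofReal_eq_zero]; positivity
  · refine tendsto_nhdsWithin_iff.mpr ⟨?_, ?_⟩
    · refine Tendsto.mono_left ?_ nhdsWithin_le_nhds
      have h2 := (continuousAt_sqrt (z := 0) (Or.inl le_rfl)).tendsto.comp hz
      simpa using h2.norm
    · filter_upwards [self_mem_nhdsWithin] with u hu
      exact norm_pos_iff.mpr (sqrt_ne_zero' hu)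

/-- The momentum as a function of complex time. -/
noncomputable def complexMomentum (t : ℂ) : ℂ := momentumMap (timeInv t)

theorem analyticOnNhd_complexMomentum : AnalyticOnNhd ℂ complexMomentum puncturedClosedStrip := by
  intro t ht
  rw [puncturedClosedStrip_eq] at ht
  have ht' := timeStrip_subset_image ht
  exact AnalyticAt.fun_comp (f := timeInv)
    (analyticAt_momentumMap (sepRegion_subset_timeDomain (timeInv_mem ht'))) (analyticAt_timeInv ht')

theorem timeInv_zero : timeInv 0 = 0 := by
  have := timeInv_timeMap (u := 0) (by exact_mod_cast ofReal_mem_sepRegion 0)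
  rwa [timeMap_zero] at this

theorem zeros_complexMomentum : {t ∈ puncturedClosedStrip | complexMomentum t = 0} = {0} := by
  rw [puncturedClosedStrip_eq]
  ext t
  constructor
  · rintro ⟨ht, h⟩
    have ht' := timeStrip_subset_image ht
    rw [complexMomentum,
      momentumMap_eq_zero_iff (sepRegion_subset_timeDomain (timeInv_mem ht'))] at h
    rw [mem_singleton_iff, ← timeMap_timeInv ht', h, timeMap_zero]
  · rintro rfl
    refine ⟨zero_mem_timeStrip, ?_⟩
    rw [complexMomentum, timeInv_zero]
    simp [momentumMap]

theorem tendsto_norm_complexMomentum_of {t c : ℂ} (h : Tendsto timeInv (𝓝[timeStrip] t) (𝓝 c))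
    (hc : sepZ c = 0) :
    Tendsto (fun t => ‖complexMomentum t‖) (𝓝[timeStrip] t) atTop := by
  refine (tendsto_norm_momentumMap hc).comp (tendsto_nhdsWithin_iff.mpr ⟨h, ?_⟩)
  filter_upwards [self_mem_nhdsWithin] with s hs
  exact sepRegion_subset_timeDomain (timeInv_mem (timeStrip_subset_image hs))

theorem sepZ_sepCorner : sepZ sepCorner = 0 := by
  rw [sepZ, sepCorner, mul_pow, ← ofReal_pow, sq_sqrt_sepN, I_sq]; ring

theorem tendsto_norm_complexMomentum :
    Tendsto (fun t => ‖complexMomentum t‖) (𝓝[puncturedClosedStrip] (I * stripWidth)) atTop ∧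
    Tendsto (fun t => ‖complexMomentum t‖) (𝓝[puncturedClosedStrip] (-(I * stripWidth)))
      atTop := by
  rw [puncturedClosedStrip_eq, mul_comm I, ← cornerHeight_eq_stripWidth]
  exact ⟨tendsto_norm_complexMomentum_of tendsto_timeInv_sepCorner sepZ_sepCorner,
    tendsto_norm_complexMomentum_of tendsto_timeInv_neg_sepCorner
      ((sepZ_neg _).trans sepZ_sepCorner)⟩

/-- Identity theorem: the punctured closed strip is preconnected and the real points accumulate at
0. -/
theorem IsStripContinuation.eqOn {f : ℝ → ℝ} {g₁ g₂ : ℂ → ℂ} (h₁ : IsStripContinuation f g₁)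
    (h₂ : IsStripContinuation f g₂) : EqOn g₁ g₂ puncturedClosedStrip := by
  have h0 : (0 : ℂ) ∈ puncturedClosedStrip := puncturedClosedStrip_eq ▸ zero_mem_timeStrip
  refine h₁.1.eqOn_of_preconnected_of_frequently_eq h₂.1
    (puncturedClosedStrip_eq ▸ isPreconnected_timeStrip) h0 ?_
  have h3 : Tendsto (fun x : ℝ => (x : ℂ)) (𝓝[≠] 0) (𝓝[≠] 0) := by
    refine tendsto_nhdsWithin_iff.mpr ⟨?_, ?_⟩
    · exact (continuous_ofReal.tendsto' 0 0 ofReal_zero).mono_left nhdsWithin_le_nhds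
    · filter_upwards [self_mem_nhdsWithin] with x hx
      simpa using hx
  exact h3.frequently (Frequently.of_forall fun x => by rw [h₁.2, h₂.2])

end MomentumMap

/-! ### The inverse of the time map on the real axis -/

section RealInverse

open Complex

theorem ofReal_mem_timeStrip (t : ℝ) : (t : ℂ) ∈ timeStrip := by
  have hA := cornerHeight_pos
  refine ⟨by simpa using hA.le, ?_⟩
  rintro (h | h)
  · have := congrArg im h; simp at this; linarith
  · have := congrArg im h; simp at this; linarith

theorem ofReal_mem_image (t : ℝ) : (t : ℂ) ∈ timeMap '' sepRegion :=
  timeStrip_subset_image (ofReal_mem_timeStrip t)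

/-- The value of `u` at a real time. -/
noncomputable def realInv (t : ℝ) : ℝ := (timeInv t).re

/-- A preimage of a real time and its conjugate have the same image, so injectivity makes the
preimage real. -/
theorem timeInv_ofReal (t : ℝ) : timeInv t = (realInv t : ℝ) := by
  have hm := timeInv_mem (ofReal_mem_image t)
  have h : starRingEnd ℂ (timeInv t) = timeInv t := by
    refine injOn_timeMap (conj_mem_sepRegion.mpr hm) hm ?_
    rw [timeMap_conj (sepRegion_subset_sepClosedRegion hm), timeMap_timeInv (ofReal_mem_image t),
      conj_ofReal]
  exact (conj_eq_iff_re.mp h).symm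

theorem realInv_realTime (x : ℝ) : realInv (realTime x) = x := by
  rw [realInv, ← timeMap_ofReal, timeInv_timeMap (ofReal_mem_sepRegion x), ofReal_re]

theorem hasDerivAt_realInv (t : ℝ) : HasDerivAt realInv (realDensity (realInv t))⁻¹ t := by
  have h1 := (hasDerivAt_timeInv (ofReal_mem_image t)).comp_ofReal
  have h2 := reCLM.hasFDerivAt.comp_hasDerivAt t h1
  rw [timeInv_ofReal, timeDensity_ofReal, ← ofReal_inv] at h2
  exact h2

theorem strictMono_realInv : StrictMono realInv :=
  strictMono_of_deriv_pos fun t => by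
    rw [(hasDerivAt_realInv t).deriv]
    exact inv_pos.mpr (realDensity_pos _)

theorem tendsto_realInv_atTop : Tendsto realInv atTop atTop :=
  tendsto_atTop_atTop.mpr fun b => ⟨realTime b, fun t ht => by
    simpa [realInv_realTime] using strictMono_realInv.monotone ht⟩

theorem tendsto_realInv_atBot : Tendsto realInv atBot atBot :=
  tendsto_atBot_atBot.mpr fun b => ⟨realTime b, fun t ht => by
    simpa [realInv_realTime] using strictMono_realInv.monotone ht⟩

end RealInverse

/-! ### The explicit separatrix -/

section ExplicitSolution

/-- The cosine of half the angle on the separatrix. -/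
noncomputable def cosHalfAngle (x : ℝ) : ℝ := (sepN + x ^ 2) / (1 + (sepN + x ^ 2))

/-- The energy relation solved for Λ, on the branch with the sign of x, so that the angle decreases
for positive time. -/
noncomputable def realMomentum (x : ℝ) : ℝ :=
  √21 / 3 * (x / (1 + (sepN + x ^ 2))) * (√(sepN + x ^ 2 + sepM) / √(sepN + x ^ 2))

theorem momentumMap_ofReal (x : ℝ) : momentumMap x = (realMomentum x : ℝ) := by
  have h1 := sepN_add_sq_pos x
  have e2 : ((sepN + x ^ 2 : ℝ) : ℂ) + sepM = ((sepN + x ^ 2 + sepM : ℝ) : ℂ) := by push_cast; rfl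
  rw [momentumMap, realMomentum, sepZ_ofReal, e2, Complex.sqrt_ofReal h1.le,
    Complex.sqrt_ofReal (by linarith [sepM_pos])]
  push_cast
  rfl

theorem cosHalfAngle_pos (x : ℝ) : 0 < cosHalfAngle x := by
  have := sepN_add_sq_pos x
  unfold cosHalfAngle
  positivity

theorem cosHalfAngle_lt_one (x : ℝ) : cosHalfAngle x < 1 := by
  have := sepN_add_sq_pos x
  rw [cosHalfAngle, div_lt_one (by positivity)]
  linarith

theorem sqrt_one_sub_cosHalfAngle_sq (x : ℝ) :
    √(1 - cosHalfAngle x ^ 2) = √(2 * (sepN + x ^ 2) + 1) / (1 + (sepN + x ^ 2)) := by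
  have := sepN_add_sq_pos x
  have h : 1 - cosHalfAngle x ^ 2 = (2 * (sepN + x ^ 2) + 1) / (1 + (sepN + x ^ 2)) ^ 2 := by
    rw [cosHalfAngle]
    field_simp
    ring
  rw [h, Real.sqrt_div (by positivity), Real.sqrt_sq (by positivity)]

noncomputable def separatrixAngle (x : ℝ) : ℝ := 2 * Real.arccos (cosHalfAngle x)

theorem cos_arccos_cosHalfAngle (x : ℝ) : Real.cos (Real.arccos (cosHalfAngle x)) =
    cosHalfAngle x :=
  Real.cos_arccos (by linarith [cosHalfAngle_pos x]) (cosHalfAngle_lt_one x).le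

theorem cos_separatrixAngle (x : ℝ) :
    Real.cos (separatrixAngle x) = 2 * cosHalfAngle x ^ 2 - 1 := by
  rw [separatrixAngle, Real.cos_two_mul, cos_arccos_cosHalfAngle]

theorem sin_separatrixAngle (x : ℝ) : Real.sin (separatrixAngle x) =
    2 * (√(2 * (sepN + x ^ 2) + 1) / (1 + (sepN + x ^ 2))) * cosHalfAngle x := by
  rw [separatrixAngle, Real.sin_two_mul, cos_arccos_cosHalfAngle, Real.sin_arccos,
    sqrt_one_sub_cosHalfAngle_sq]

theorem hasDerivAt_sepN_add_sq (x : ℝ) : HasDerivAt (fun x : ℝ => sepN + x ^ 2) (2 * x) x := by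
  simpa using (hasDerivAt_pow 2 x).const_add sepN

/-- The first equation of motion, written with the derivative of time in u; this relation is what
dictates the density. -/
theorem hasDerivAt_separatrixAngle (x : ℝ) :
    HasDerivAt separatrixAngle (-3 * realMomentum x * realDensity x) x := by
  have hz := sepN_add_sq_pos x
  have hm := sepM_pos
  have hd := hasDerivAt_sepN_add_sq x
  have hq : HasDerivAt cosHalfAngle (2 * x / (1 + (sepN + x ^ 2)) ^ 2) x :=
    (hd.div (hd.const_add 1) (by positivity)).congr_deriv (by ring)
  have hr := Real.sqrt_pos.mpr (show 0 < 2 * (sepN + x ^ 2) + 1 by positivity)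
  have hp := Real.sqrt_pos.mpr hz
  have hs := Real.sqrt_pos.mpr (show 0 < sepN + x ^ 2 + sepM by positivity)
  have h1 := Real.hasDerivAt_arccos (x := cosHalfAngle x) (by linarith [cosHalfAngle_pos x])
    (cosHalfAngle_lt_one x).ne
  refine ((h1.comp x hq).const_mul 2).congr_deriv ?_
  rw [sqrt_one_sub_cosHalfAngle_sq, realMomentum, realDensity]
  have h21 : 0 < √(21 : ℝ) := by positivity
  field_simp
  ring

theorem two_add_two_cos_rpow (x : ℝ) :
    (2 + 2 * Real.cos (separatrixAngle x)) ^ (3 / 2 : ℝ) = 8 * cosHalfAngle x ^ 3 := by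
  have h := cosHalfAngle_pos x
  have e : 2 + 2 * Real.cos (separatrixAngle x) = (2 * cosHalfAngle x) ^ (2 : ℝ) := by
    rw [cos_separatrixAngle, Real.rpow_two]; ring
  rw [e, ← Real.rpow_mul (by positivity)]
  norm_num
  ring

theorem hasDerivAt_realMomentum (x : ℝ) :
    HasDerivAt realMomentum ((pendulumField (separatrixAngle x, realMomentum x)).2 *
      realDensity x) x := by
  have hz := sepN_add_sq_pos x
  have hm := sepM_pos
  have hd := hasDerivAt_sepN_add_sq x
  have hr := Real.sqrt_pos.mpr (show 0 < 2 * (sepN + x ^ 2) + 1 by positivity)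
  have hp := Real.sqrt_pos.mpr hz
  have hs := Real.sqrt_pos.mpr (show 0 < sepN + x ^ 2 + sepM by positivity)
  have h21 : 0 < √(21 : ℝ) := by positivity
  have h1 := ((hasDerivAt_id x).div (hd.const_add 1) (by positivity)).const_mul (√21 / 3)
  have h2 := ((hd.add_const sepM).sqrt (by positivity)).div (hd.sqrt hz.ne') hp.ne'
  refine (h1.mul h2).congr_deriv ?_
  simp only [pendulumField, sin_separatrixAngle, two_add_two_cos_rpow]
  rw [realDensity, cosHalfAngle]
  have e1 := Real.sq_sqrt hz.le
  have e2 := Real.sq_sqrt (show 0 ≤ sepN + x ^ 2 + sepM by positivity)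
  have e3 := Real.sq_sqrt (show (0 : ℝ) ≤ 21 by norm_num)
  have c1 := sepM_eq
  have c2 := sepM_mul_sepN
  simp only [id, Pi.div_apply]
  have e4 : x ^ 2 = (sepN + x ^ 2) - sepN := by ring
  generalize √(2 * (sepN + x ^ 2) + 1) = r at *
  generalize √(sepN + x ^ 2 + sepM) = s at *
  generalize √(sepN + x ^ 2) = p at *
  generalize √(21 : ℝ) = k at *
  generalize sepN + x ^ 2 = z at *
  -- After common root factors are removed only squares of roots remain. What is left is a rational
  -- identity in z that follows from M = N + 2/7 and M N = 1/7.
  have key : (1 + z - 2 * x ^ 2) / (1 + z) ^ 2 * s ^ 2 + x ^ 2 / (1 + z) * ((p ^ 2 - s ^ 2) / p ^ 2)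
      = 4 / 7 * p ^ 2 * (-2 * z / (1 + z) ^ 2 * (1 - (1 + z) ^ 3 / (8 * z ^ 3))) := by
    rw [e1, e2, e4, c1]
    rw [c1] at c2
    field_simp
    linear_combination (56 + 168 * z) * c2
  calc _ = k / 3 * (1 / (s * p)) * ((1 + z - 2 * x ^ 2) / (1 + z) ^ 2 * s ^ 2 +
        x ^ 2 / (1 + z) * ((p ^ 2 - s ^ 2) / p ^ 2)) := by
        field_simp
    _ = _ := by
        rw [key]
        field_simp
        rw [e3]
        ring

theorem tendsto_separatrixAngle {l : Filter ℝ} (hl : Tendsto (fun x : ℝ => x ^ 2) l atTop) :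
    Tendsto separatrixAngle l (𝓝 0) := by
  have h1 : Tendsto (fun x : ℝ => 1 + (sepN + x ^ 2)) l atTop :=
    tendsto_atTop_add_const_left _ _ (tendsto_atTop_add_const_left _ _ hl)
  have h2 : Tendsto cosHalfAngle l (𝓝 1) := by
    have h3 := (tendsto_inv_atTop_zero.comp h1).const_sub 1
    rw [sub_zero] at h3
    refine h3.congr fun x => ?_
    have := sepN_add_sq_pos x
    simp only [Function.comp_apply, cosHalfAngle]
    field_simp
    ring
  have h4 := ((Real.continuous_arccos.tendsto 1).comp h2).const_mul 2
  rwa [Real.arccos_one, mul_zero] at h4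

theorem realMomentum_sq_le (x : ℝ) : realMomentum x ^ 2 ≤ 7 / 3 * (sepN + x ^ 2)⁻¹ := by
  have hz := sepN_add_sq_pos x
  have hm := sepM_pos
  have hm1 := sepM_lt_one
  have hn := sepN_pos
  have e : realMomentum x ^ 2 = 7 / 3 * (sepN + x ^ 2)⁻¹ *
      ((x ^ 2 * (sepN + x ^ 2 + sepM)) / (1 + (sepN + x ^ 2)) ^ 2) := by
    rw [realMomentum, mul_pow, mul_pow, div_pow, div_pow, div_pow, Real.sq_sqrt (by norm_num),
      Real.sq_sqrt hz.le, Real.sq_sqrt (by positivity)]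
    field_simp
    ring
  rw [e]
  refine mul_le_of_le_one_right (by positivity) ?_
  rw [div_le_one (by positivity), sq (1 + _)]
  exact mul_le_mul (by linarith) (by linarith) (by positivity) (by positivity)

theorem tendsto_realMomentum {l : Filter ℝ} (hl : Tendsto (fun x : ℝ => x ^ 2) l atTop) :
    Tendsto realMomentum l (𝓝 0) := by
  have h1 : Tendsto (fun x : ℝ => 7 / 3 * (sepN + x ^ 2)⁻¹) l (𝓝 0) := by
    have := (tendsto_inv_atTop_zero.comp (tendsto_atTop_add_const_left l sepN hl)).const_mul (7 / 3)
    simpa using this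
  have h2 : Tendsto (fun x => realMomentum x ^ 2) l (𝓝 0) :=
    squeeze_zero (fun x => sq_nonneg _) realMomentum_sq_le h1
  have h3 := (Real.continuous_sqrt.tendsto 0).comp h2
  rw [Real.sqrt_zero] at h3
  rw [tendsto_zero_iff_abs_tendsto_zero]
  refine h3.congr fun x => ?_
  simp [Function.comp_apply, Real.sqrt_sq_eq_abs]

/-- The time parametrization of the separatrix. -/
noncomputable def separatrix (t : ℝ) : ℝ × ℝ :=
  (separatrixAngle (realInv t), realMomentum (realInv t))

theorem separatrixAngle_zero : separatrixAngle 0 = 2 * Real.arccos aPlus := by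
  rw [separatrixAngle, cosHalfAngle, aPlus_eq]; simp

theorem realInv_zero : realInv 0 = 0 := by
  have := realInv_realTime 0
  rwa [realTime_zero] at this

theorem separatrix_zero : separatrix 0 = (2 * Real.arccos aPlus, 0) := by
  rw [separatrix, realInv_zero, separatrixAngle_zero, realMomentum]; simp

theorem isSeparatrix_separatrix : IsSeparatrix separatrix where
  hasDerivAt t := by
    have h := realDensity_pos (realInv t)
    have h1 := (hasDerivAt_separatrixAngle (realInv t)).comp t (hasDerivAt_realInv t)
    have h2 := (hasDerivAt_realMomentum (realInv t)).comp t (hasDerivAt_realInv t)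
    rw [mul_assoc, mul_inv_cancel₀ h.ne', mul_one] at h1 h2
    exact h1.prodMk h2
  collision_free t := by
    have := cosHalfAngle_pos (realInv t)
    simp only [separatrix, cos_separatrixAngle]
    intro h
    have : 0 < cosHalfAngle (realInv t) ^ 2 := by positivity
    linarith
  tendsto_atTop := by
    have h : Tendsto (fun t => realInv t ^ 2) atTop atTop :=
      (tendsto_pow_atTop two_ne_zero).comp tendsto_realInv_atTop
    have h' : Tendsto (fun x : ℝ => x ^ 2) (map realInv atTop) atTop := tendsto_map'_iff.mpr h
    exact (tendsto_map'_iff.mp (tendsto_separatrixAngle h')).prodMk_nhds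
      (tendsto_map'_iff.mp (tendsto_realMomentum h'))
  tendsto_atBot := by
    have h : Tendsto (fun t => realInv t ^ 2) atBot atTop := by
      have := (tendsto_pow_atTop two_ne_zero).comp (tendsto_neg_atBot_atTop.comp
        tendsto_realInv_atBot)
      refine this.congr fun t => ?_
      simp
    have h' : Tendsto (fun x : ℝ => x ^ 2) (map realInv atBot) atTop := tendsto_map'_iff.mpr h
    exact (tendsto_map'_iff.mp (tendsto_separatrixAngle h')).prodMk_nhds
      (tendsto_map'_iff.mp (tendsto_realMomentum h'))
  init_angle := by
    have hn := sepN_pos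
    have h1 : 0 < aPlus := by rw [aPlus_eq]; positivity
    have h2 : aPlus < 1 / 2 := by
      rw [aPlus_eq, div_lt_div_iff₀ (by linarith) (by norm_num)]
      linarith [sepN_lt_one]
    rw [separatrix_zero]
    have e1 : Real.arccos (1 / 2) = Real.pi / 3 := by
      rw [← Real.cos_pi_div_three, Real.arccos_cos] <;> linarith [Real.pi_pos]
    have h3 := Real.arccos_lt_arccos (by linarith) h2 (by norm_num)
    have h4 := (Real.arccos_lt_pi_div_two).mpr h1
    constructor
    · rw [e1] at h3; dsimp only; linarith
    · dsimp only; linarith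
  init_momentum := by rw [separatrix_zero]

end ExplicitSolution

/-! ### Energy, the initial point and uniqueness of the separatrix -/

section Uniqueness

/-- The energy of the Hamiltonian system. -/
noncomputable def pendulumEnergy (p : ℝ × ℝ) : ℝ :=
  -(3 / 2) * p.2 ^ 2 + 1 - Real.cos p.1 - 1 / √(2 + 2 * Real.cos p.1)

theorem two_add_two_cos_pos {x : ℝ} (h : Real.cos x ≠ -1) : 0 < 2 + 2 * Real.cos x := by
  have := lt_of_le_of_ne (Real.neg_one_le_cos x) h.symm
  linarith

theorem rpow_three_halves {s : ℝ} (hs : 0 < s) : s ^ (3 / 2 : ℝ) = s * √s := by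
  rw [Real.sqrt_eq_rpow, show (3 / 2 : ℝ) = 1 + 1 / 2 by norm_num, Real.rpow_add hs, Real.rpow_one]

theorem hasDerivAt_pendulumEnergy {σ : ℝ → ℝ × ℝ} {t : ℝ}
    (hσ : HasDerivAt σ (pendulumField (σ t)) t) (hc : Real.cos (σ t).1 ≠ -1) :
    HasDerivAt (fun t => pendulumEnergy (σ t)) 0 t := by
  have hs := two_add_two_cos_pos hc
  have hr := Real.sqrt_pos.mpr hs
  have h1 : HasDerivAt (fun t => (σ t).1) (-3 * (σ t).2) t :=
    hasFDerivAt_fst.comp_hasDerivAt (f := σ) t hσ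
  have h2 : HasDerivAt (fun t => (σ t).2) (pendulumField (σ t)).2 t :=
    hasFDerivAt_snd.comp_hasDerivAt (f := σ) t hσ
  have h3 := h1.cos
  have h4 := (((h3.const_mul 2).const_add 2).sqrt hs.ne').inv hr.ne'
  have h5 := ((((h2.pow 2).const_mul (-(3 / 2))).add_const 1).sub h3).sub h4
  have h6 : HasDerivAt (fun t => pendulumEnergy (σ t)) _ t :=
    h5.congr_of_eventuallyEq (Eventually.of_forall fun t => by
      simp [pendulumEnergy])
  refine h6.congr_deriv ?_
  simp only [pendulumField, rpow_three_halves hs]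
  rw [Real.sq_sqrt hs.le]
  field_simp
  ring

/-- Energy is constant along the solution and continuous at the saddle, where it equals -1/2. -/
theorem IsSeparatrix.energy_eq {σ : ℝ → ℝ × ℝ} (hσ : IsSeparatrix σ) (t : ℝ) :
    pendulumEnergy (σ t) = -(1 / 2) := by
  have hd : ∀ t, HasDerivAt (fun t => pendulumEnergy (σ t)) 0 t := fun t =>
    hasDerivAt_pendulumEnergy (hσ.hasDerivAt t) (hσ.collision_free t)
  have hconst : ∀ s, pendulumEnergy (σ s) = pendulumEnergy (σ t) := fun s =>
    is_const_of_deriv_eq_zero (fun x => (hd x).differentiableAt) (fun x => (hd x).deriv) s t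
  have hcont : ContinuousAt pendulumEnergy ((0 : ℝ), (0 : ℝ)) := by
    unfold pendulumEnergy
    have h : √(2 + 2 * Real.cos (((0 : ℝ), (0 : ℝ)) : ℝ × ℝ).1) ≠ 0 := by
      simp only [Real.cos_zero]; positivity
    fun_prop (disch := exact h)
  have h1 := hcont.tendsto.comp hσ.tendsto_atTop
  have h2 : Tendsto (pendulumEnergy ∘ σ) atTop (𝓝 (pendulumEnergy (σ t))) :=
    tendsto_const_nhds.congr fun s => (hconst s).symm
  rw [tendsto_nhds_unique h2 h1, pendulumEnergy]
  have h4 : √(2 + 2 * 1 : ℝ) = 2 := by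
    rw [show (2 + 2 * 1 : ℝ) = 2 ^ 2 by norm_num, Real.sqrt_sq zero_le_two]
  simp only [Real.cos_zero, h4]
  norm_num

/-- At Λ = 0 the energy relation is the cubic (1 - q)(q - a₊)(q - a₋) = 0 in q = cos(λ/2); the range
of the initial angle gives 0 < q < 1, which leaves only a₊. -/
theorem IsSeparatrix.apply_zero {σ : ℝ → ℝ × ℝ} (hσ : IsSeparatrix σ) :
    σ 0 = (2 * Real.arccos aPlus, 0) := by
  obtain ⟨h1, h2⟩ := hσ.init_angle
  have hE := hσ.energy_eq 0
  have hpi := Real.pi_pos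
  set θ := (σ 0).1 / 2 with hθ
  have hθ2 : (σ 0).1 = 2 * θ := by rw [hθ]; ring
  have hc0 : 0 < Real.cos θ := Real.cos_pos_of_mem_Ioo ⟨by linarith, by linarith⟩
  have hc1 : Real.cos θ < 1 := by
    rw [← Real.cos_zero]
    exact Real.cos_lt_cos_of_nonneg_of_le_pi_div_two le_rfl (by linarith) (by linarith)
  rw [pendulumEnergy, hσ.init_momentum, hθ2, Real.cos_two_mul] at hE
  have hsq : 2 + 2 * (2 * Real.cos θ ^ 2 - 1) = (2 * Real.cos θ) ^ 2 := by ring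
  rw [hsq, Real.sqrt_sq (by positivity)] at hE
  have hpoly : (1 - Real.cos θ) * ((Real.cos θ - aPlus) * (Real.cos θ - aMinus)) = 0 := by
    field_simp at hE
    have := Real.mul_self_sqrt (show (0 : ℝ) ≤ 2 by norm_num)
    rw [aPlus, aMinus]
    linear_combination (1 / 4) * hE + (-(1 - Real.cos θ) / 4) * this
  have haM : aMinus < 0 := by
    rw [aMinus]; have := Real.sqrt_nonneg 2; linarith
  have hcos : Real.cos θ = aPlus := by
    rcases mul_eq_zero.mp hpoly with h | h
    · linarith
    · rcases mul_eq_zero.mp h with h | h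
      · linarith
      · linarith
  have : θ = Real.arccos aPlus := by
    rw [← hcos, Real.arccos_cos] <;> linarith
  exact Prod.ext (by rw [hθ2, this]) hσ.init_momentum

theorem contDiffAt_pendulumField {p : ℝ × ℝ} (hp : Real.cos p.1 ≠ -1) :
    ContDiffAt ℝ 1 pendulumField p := by
  have hs := two_add_two_cos_pos hp
  have h1 : ContDiffAt ℝ 1 (fun p : ℝ × ℝ => Real.cos p.1) p :=
    Real.contDiff_cos.contDiffAt.comp p contDiffAt_fst
  have h2 : ContDiffAt ℝ 1 (fun p : ℝ × ℝ => Real.sin p.1) p :=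
    Real.contDiff_sin.contDiffAt.comp p contDiffAt_fst
  have h3 : ContDiffAt ℝ 1 (fun p : ℝ × ℝ => (2 + 2 * Real.cos p.1) ^ (3 / 2 : ℝ)) p :=
    (contDiffAt_const.add (contDiffAt_const.mul h1)).rpow_const_of_ne hs.ne'
  have h4 := contDiffAt_const (c := (1 : ℝ)).div h3 (Real.rpow_pos_of_pos hs _).ne'
  exact (contDiffAt_const.mul contDiffAt_snd).prodMk (h2.neg.mul (contDiffAt_const.sub h4))

theorem IsSeparatrix.continuous {σ : ℝ → ℝ × ℝ} (hσ : IsSeparatrix σ) : Continuous σ :=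
  continuous_iff_continuousAt.mpr fun t => (hσ.hasDerivAt t).continuousAt

/-- Both solutions start at the same point. On a bounded time interval their orbits form a compact
set free of collisions, where the field is C¹ and therefore Lipschitz, so the uniqueness theorem for
differential equations applies. -/
theorem IsSeparatrix.unique {σ τ : ℝ → ℝ × ℝ} (hσ : IsSeparatrix σ) (hτ : IsSeparatrix τ) :
    σ = τ := by
  funext t
  set R := |t| + 1 with hR
  set K := σ '' Icc (-R) R ∪ τ '' Icc (-R) R with hKdef
  have hK : IsCompact K :=
    (isCompact_Icc.image hσ.continuous).union (isCompact_Icc.image hτ.continuous)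
  have hloc : LocallyLipschitzOn K pendulumField := by
    intro p hp
    have hp' : Real.cos p.1 ≠ -1 := by
      rcases hp with ⟨s, -, rfl⟩ | ⟨s, -, rfl⟩
      · exact hσ.collision_free s
      · exact hτ.collision_free s
    obtain ⟨C, V, hV, hL⟩ := (contDiffAt_pendulumField hp').exists_lipschitzOnWith
    exact ⟨C, V, mem_nhdsWithin_of_mem_nhds hV, hL⟩
  obtain ⟨C, hC⟩ := hloc.exists_lipschitzOnWith_of_compact hK
  have ht0 := abs_nonneg t
  refine ODE_solution_unique_of_mem_Icc (v := fun _ => pendulumField) (s := fun _ => K)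
    (a := -R) (b := R) (t₀ := 0) (fun _ _ => hC) ⟨by linarith, by linarith⟩
    hσ.continuous.continuousOn (fun s _ => hσ.hasDerivAt s)
    (fun s hs => Or.inl ⟨s, Ioo_subset_Icc_self hs, rfl⟩)
    hτ.continuous.continuousOn (fun s _ => hτ.hasDerivAt s)
    (fun s hs => Or.inr ⟨s, Ioo_subset_Icc_self hs, rfl⟩)
    (by rw [hσ.apply_zero, hτ.apply_zero]) ?_
  exact ⟨by linarith [neg_abs_le t], by linarith [le_abs_self t]⟩

theorem isStripContinuation_complexMomentum :
    IsStripContinuation (fun t => (separatrix t).2) complexMomentum :=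
  ⟨analyticOnNhd_complexMomentum, fun t => by
    rw [complexMomentum, timeInv_ofReal, momentumMap_ofReal]; rfl⟩

end Uniqueness

/-! ### The main theorem -/

theorem proposition2p3 :
    (∃! σ : ℝ → ℝ × ℝ, IsSeparatrix σ) ∧
    ∀ σ : ℝ → ℝ × ℝ, IsSeparatrix σ →
      (∃ Λ : ℂ → ℂ, IsStripContinuation (fun t => (σ t).2) Λ) ∧
      ∀ Λ : ℂ → ℂ, IsStripContinuation (fun t => (σ t).2) Λ →
        {t ∈ puncturedClosedStrip | Λ t = 0} = {0} ∧
        Tendsto (fun t => ‖Λ t‖) (𝓝[puncturedClosedStrip] (Complex.I * stripWidth)) atTop ∧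
        Tendsto (fun t => ‖Λ t‖) (𝓝[puncturedClosedStrip] (-(Complex.I * stripWidth))) atTop := by
  refine ⟨⟨separatrix, isSeparatrix_separatrix, fun τ hτ => hτ.unique isSeparatrix_separatrix⟩,
    fun σ hσ => ?_⟩
  obtain rfl := hσ.unique isSeparatrix_separatrix
  refine ⟨⟨complexMomentum, isStripContinuation_complexMomentum⟩, fun Λ hΛ => ?_⟩
  have heq := isStripContinuation_complexMomentum.eqOn hΛ
  have hev : ∀ c, (fun t => ‖complexMomentum t‖) =ᶠ[𝓝[puncturedClosedStrip] c]
      fun t => ‖Λ t‖ := fun c => by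
    filter_upwards [self_mem_nhdsWithin] with t ht
    rw [heq ht]
  refine ⟨?_, tendsto_norm_complexMomentum.1.congr' (hev _),
    tendsto_norm_complexMomentum.2.congr' (hev _)⟩
  rw [← zeros_complexMomentum]
  ext t
  exact and_congr_right fun ht => by rw [heq ht]
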